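/- **Setting.** Let $\mathsf N$ be the number of sites, $2s_1,\dots,2s_{\mathsf N}$ positive integers, $\eta\in\mathbb C\setminus\{0\}$ and $\xi_1,\dots,\xi_{\mathsf N}\in\mathbb C$. Let $\mathcal H=\bigotimes_{n=1}^{\mathsf N}V_n$ with $V_n=\mathbb C^{2s_n+1}$, let $S^z_n=\mathrm{diag}(s_n,s_n-1,\dots,-s_n)$, let $S_n^+=(S_n^-)^t$ have entries $\sqrt{j(2s_n+1-j)}$, $j=1,\dots,2s_n$, on its superdiagonal and zeros elsewhere, and $$\mathsf L_{0n}(\lambda)=\begin{pmatrix}\lambda+\eta(\tfrac12+S^z_n)&\eta S_n^-\\ \eta S_n^+&\lambda+\eta(\tfrac12-S^z_n)\end{pmatrix}_0 .$$ For $K=\begin{pmatrix}a&b\\c&d\end{pmatrix}\in\mathrm{End}(\mathbb C^2)$ put $$\mathsf M_0^{(K)}(\lambda)=K_0\,\mathsf L_{0\mathsf N}(\lambda-\xi_{\mathsf N})\cdots\mathsf L_{01}(\lambda-\xi_1)=\begin{pmatrix}\mathsf A^{(K)}(\lambda)&\mathsf B^{(K)}(\lambda)\\ \mathsf C^{(K)}(\lambda)&\mathsf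 D^{(K)}(\lambda)\end{pmatrix},\qquad \mathsf T^{(K)}(\lambda)=\mathsf A^{(K)}(\lambda)+\mathsf D^{(K)}(\lambda).$$ Put $\xi_n^{(k)}=\xi_n-\tfrac\eta2+(s_n-k)\eta$, $a(\lambda)=\prod_n(\lambda-\xi_n^{(2s_n)})$ and $d(\lambda)=\prod_n(\lambda-\xi_n^{(0)})$. For $W\in GL_2(\mathbb C)$ put $\bar K=W^{-1}KW=\begin{pmatrix}\bar a&\bar b\\ \bar c&\bar d\end{pmatrix}$ and $\mathcal W=\bigotimes_nW^{(2s_n)}$, where $W^{(m)}$ is the restriction of $W^{\otimes m}$ to the symmetric tensors of $(\mathbb C^2)^{\otimes m}$, identified isometrically with $\mathbb C^{m+1}$ (the $(j+1)$-st basis vector corresponds to $\binom mj^{-1/2}$ times the sum of all basis tensors having exactly $j$ factors equal to the second basis vector of $\mathbb C^2$). For $E\in\mathrm{End}(\mathbb C^2)$ put $\mathsf R_E(\lambda)=\mathrm{tr}_0[W_0E_0W_0^{-1}\mathsf M_0^{(K)}(\lambda)]$, and let $\tilde{\mathsf A}^{(K)},\tilde{\mathsf B}^{(K)},\tilde{\mathsf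 C}^{(K)},\tilde{\mathsf D}^{(K)}$ be $\mathsf R_E$ for $E=\begin{pmatrix}1&0\\0&0\end{pmatrix},\begin{pmatrix}0&0\\1&0\end{pmatrix},\begin{pmatrix}0&1\\0&0\end{pmatrix},\begin{pmatrix}0&0\\0&1\end{pmatrix}$ respectively. A family of operators $\mathsf X(\lambda)$ on $\mathcal H$ is *diagonalizable with simple spectrum* if there is a basis of common eigenvectors whose eigenvalues, as functions of $\lambda$, are pairwise distinct. Families $\mathsf X,\mathsf R,\mathsf L$ and a scalar $\beta$ give a *separation of variables representation of Sklyanin's type* of the $\mathsf T^{(K)}$-spectral problem if $\mathsf T^{(K)}=\mathsf R+\mathsf L$ and, for all $\kappa_1\neq0$ and $\kappa_2$ with $\kappa_1\kappa_2=\det K$, there are a basis of covectors $\langle\mathbf h|=\langle h_1,\dots,h_{\mathsf N}|$, $h_n\in\{0,\dots,2s_n\}$, of $\mathcal H$ and pairwise commuting operators $Y_1,\dots,Y_{\mathsf N}$ (the quantum separate variables) such that: 1. the $Y_n$ are the operator zeros of $\mathsf X$: $\mathsf X(\lambda)=\beta\prod_{n}(\lambda-Y_n)$, and $\langle\mathbf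 h|Y_n=\xi_n^{(h_n)}\langle\mathbf h|$; 2. $\langle\mathbf h|\,\mathsf R(\xi_n^{(h_n)})=\kappa_1a(\xi_n^{(h_n)})\langle h_1,\dots,h_n+1,\dots,h_{\mathsf N}|$ and $\langle\mathbf h|\,\mathsf L(\xi_n^{(h_n)})=\kappa_2d(\xi_n^{(h_n)})\langle h_1,\dots,h_n-1,\dots,h_{\mathsf N}|$ for all $n$ (covectors with a label out of range are $0$); 3. for any function $t:\mathbb C\to\mathbb C$ and any $\psi\in\mathcal H$, $\psi\ne0$: $\mathsf T^{(K)}(\lambda)\psi=t(\lambda)\psi$ for all $\lambda$ if and only if $t$ is a polynomial of degree at most $\mathsf N$ whose coefficient of $\lambda^{\mathsf N}$ is $\mathrm{tr}\,K$ and there are a constant $C\in\mathbb C$ and functions $Q_n:\{0,\dots,2s_n\}\to\mathbb C$, extended by zero, with $\langle\mathbf h|\psi\rangle=C\prod_nQ_n(h_n)$ for all $\mathbf h$ and $$t(\xi_n^{(k)})Q_n(k)=\kappa_1a(\xi_n^{(k)})Q_n(k+1)+\kappa_2d(\xi_n^{(k)})Q_n(k-1),\qquad 0\le k\le2s_n,\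 1\le n\le\mathsf N .$$ **Theorem.** Assume that for all $i\neq j$ $$\xi_i+s_i\eta\neq\xi_j+s_j\eta\ \bmod\eta ,\qquad\text{i.e. } (\xi_i+s_i\eta)-(\xi_j+s_j\eta)\notin\eta\,\mathbb Z$$ (when $s_i-s_j$ is an integer this says $\xi_i\ne\xi_j$ mod $\eta$), and that $K\neq\alpha\,\mathbb I_{2\times2}$ for every $\alpha\in\mathbb C$. Then there is $W\in GL_2(\mathbb C)$ with $\bar b\neq0$ and $\bar c\ne0$, and the $\mathsf T^{(K)}$-spectral problem admits Sklyanin-type separation of variables representations. More precisely: a) If $b\neq0$, then $\mathsf B^{(K)}$ is diagonalizable with simple spectrum, and $\mathsf X=\mathsf B^{(K)}$, $\mathsf R=\mathsf A^{(K)}$, $\mathsf L=\mathsf D^{(K)}$, $\beta=b$ give such a representation. If $c\neq0$, then $\mathsf C^{(K)}$ is diagonalizable with simple spectrum, and $\mathsf X=\mathsf C^{(K)}$, $\mathsf R=\mathsf D^{(K)}$, $\mathsf L=\mathsf A^{(K)}$, $\beta=c$ give such a representation. b) If $b=0$, then for every $W\in GL_2(\mathbb C)$ with $\bar b\neq0$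 the operator $\mathcal W$ is invertible, $\tilde{\mathsf B}^{(K)}(\lambda)=\mathcal W\,\mathsf B^{(\bar K)}(\lambda)\,\mathcal W^{-1}$ for all $\lambda$, $\tilde{\mathsf B}^{(K)}$ is diagonalizable with simple spectrum, and $\mathsf X=\tilde{\mathsf B}^{(K)}$, $\mathsf R=\tilde{\mathsf A}^{(K)}$, $\mathsf L=\tilde{\mathsf D}^{(K)}$, $\beta=\bar b$ give such a representation. c) If $c=0$, then for every $W\in GL_2(\mathbb C)$ with $\bar c\neq0$ the operator $\mathcal W$ is invertible, $\tilde{\mathsf C}^{(K)}(\lambda)=\mathcal W\,\mathsf C^{(\bar K)}(\lambda)\,\mathcal W^{-1}$ for all $\lambda$, $\tilde{\mathsf C}^{(K)}$ is diagonalizable with simple spectrum, and $\mathsf X=\tilde{\mathsf C}^{(K)}$, $\mathsf R=\tilde{\mathsf D}^{(K)}$, $\mathsf L=\tilde{\mathsf A}^{(K)}$, $\beta=\bar c$ give such a representation. -/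

import Mathlib

open scoped Matrix

noncomputable section

namespace HigherSpin

/-- Labels of the canonical basis of `⨂ₙ ℂ^(2sₙ+1)`; `ℓ n` stands for `2 sₙ`. -/
abbrev State {N : ℕ} (ℓ : Fin N → ℕ) : Type := ∀ n : Fin N, Fin (ℓ n + 1)

/-- Operators on the quantum space `ℋ = ⨂ₙ ℂ^(2sₙ+1)`, in the canonical basis. -/
abbrev Op {N : ℕ} (ℓ : Fin N → ℕ) : Type := Matrix (State ℓ) (State ℓ) ℂ

/-- `S^z = diag(s, s-1, …, -s)` with `m = 2s`. -/
def spinZ (m : ℕ) : Matrix (Fin (m + 1)) (Fin (m + 1)) ℂ :=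
  Matrix.diagonal fun i => (m : ℂ) / 2 - ((i : ℕ) : ℂ)

/-- `S^+`, with superdiagonal entries `x(j) = √(j(2s+1-j))` for `j = i + 1 = 1, …, 2s`. -/
def spinUp (m : ℕ) : Matrix (Fin (m + 1)) (Fin (m + 1)) ℂ :=
  Matrix.of fun i j =>
    if (i : ℕ) + 1 = (j : ℕ) then
      ((Real.sqrt ((((i : ℕ) : ℝ) + 1) * ((m : ℝ) - ((i : ℕ) : ℝ))) : ℝ) : ℂ)
    else 0

/-- `S^- = (S^+)ᵗ`. -/
def spinDown (m : ℕ) : Matrix (Fin (m + 1)) (Fin (m + 1)) ℂ := (spinUp m)ᵀ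

/-- The tensor product `⨂ₙ Aₙ` of operators on the local spaces. -/
def tensorOp {N : ℕ} (ℓ : Fin N → ℕ)
    (A : ∀ n : Fin N, Matrix (Fin (ℓ n + 1)) (Fin (ℓ n + 1)) ℂ) : Op ℓ :=
  Matrix.of fun g h => ∏ n, A n (g n) (h n)

/-- The operator acting as `A` on the `n`-th factor and as the identity on the others. -/
def siteOp {N : ℕ} (ℓ : Fin N → ℕ) (n : Fin N)
    (A : Matrix (Fin (ℓ n + 1)) (Fin (ℓ n + 1)) ℂ) : Op ℓ :=
  tensorOp ℓ (Function.update (fun _ => 1) n A)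

/-- The Lax operator of site `n`, a `2 × 2` matrix (auxiliary space) with entries in `End ℋ`. -/
def lax {N : ℕ} (ℓ : Fin N → ℕ) (η : ℂ) (n : Fin N) (x : ℂ) : Matrix (Fin 2) (Fin 2) (Op ℓ) :=
  !![(x + η / 2) • (1 : Op ℓ) + η • siteOp ℓ n (spinZ (ℓ n)), η • siteOp ℓ n (spinDown (ℓ n));
     η • siteOp ℓ n (spinUp (ℓ n)), (x + η / 2) • (1 : Op ℓ) - η • siteOp ℓ n (spinZ (ℓ n))]

/-- A `2 × 2` complex matrix acting on the auxiliary space only. -/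
def aux {N : ℕ} (ℓ : Fin N → ℕ) (K : Matrix (Fin 2) (Fin 2) ℂ) : Matrix (Fin 2) (Fin 2) (Op ℓ) :=
  K.map fun z => z • (1 : Op ℓ)

/-- The monodromy matrix `K₀ L_{0N}(x - ξ_N) ⋯ L_{01}(x - ξ_1)`. -/
def monodromy {N : ℕ} (ℓ : Fin N → ℕ) (η : ℂ) (ξ : Fin N → ℂ) (K : Matrix (Fin 2) (Fin 2) ℂ)
    (x : ℂ) : Matrix (Fin 2) (Fin 2) (Op ℓ) :=
  aux ℓ K * (List.ofFn fun n => lax ℓ η n (x - ξ n)).reverse.prod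

/-- The transfer matrix `T^{(K)}(x)`, the trace of the monodromy matrix over the auxiliary space. -/
def transfer {N : ℕ} (ℓ : Fin N → ℕ) (η : ℂ) (ξ : Fin N → ℂ) (K : Matrix (Fin 2) (Fin 2) ℂ)
    (x : ℂ) : Op ℓ :=
  (monodromy ℓ η ξ K x).trace

/-- `A^{(K)}(x)`. -/
def opA {N : ℕ} (ℓ : Fin N → ℕ) (η : ℂ) (ξ : Fin N → ℂ) (K : Matrix (Fin 2) (Fin 2) ℂ)
    (x : ℂ) : Op ℓ := monodromy ℓ η ξ K x 0 0

/-- `B^{(K)}(x)`. -/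
def opB {N : ℕ} (ℓ : Fin N → ℕ) (η : ℂ) (ξ : Fin N → ℂ) (K : Matrix (Fin 2) (Fin 2) ℂ)
    (x : ℂ) : Op ℓ := monodromy ℓ η ξ K x 0 1

/-- `C^{(K)}(x)`. -/
def opC {N : ℕ} (ℓ : Fin N → ℕ) (η : ℂ) (ξ : Fin N → ℂ) (K : Matrix (Fin 2) (Fin 2) ℂ)
    (x : ℂ) : Op ℓ := monodromy ℓ η ξ K x 1 0

/-- `D^{(K)}(x)`. -/
def opD {N : ℕ} (ℓ : Fin N → ℕ) (η : ℂ) (ξ : Fin N → ℂ) (K : Matrix (Fin 2) (Fin 2) ℂ)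
    (x : ℂ) : Op ℓ := monodromy ℓ η ξ K x 1 1

/-- `tr_a [W_a E_a W_a⁻¹ M_a^{(K)}(x)]`. With `E = !![0, 0; 1, 0]` and `E = !![0, 1; 0, 0]` these
are `B̃^{(K)}` and `C̃^{(K)}`; with the two diagonal matrix units, `Ã^{(K)}` and `D̃^{(K)}`. -/
def rotated {N : ℕ} (ℓ : Fin N → ℕ) (η : ℂ) (ξ : Fin N → ℂ) (K W E : Matrix (Fin 2) (Fin 2) ℂ)
    (x : ℂ) : Op ℓ :=
  (aux ℓ (W * E * W⁻¹) * monodromy ℓ η ξ K x).trace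

/-- The isometric identification of `ℂ^(m+1)` with the symmetric part of `(ℂ²)^{⊗m}`: the `j`-th
basis vector goes to `(m choose j)^{-1/2}` times the sum of the basis tensors with exactly `j`
factors equal to the second basis vector of `ℂ²`. -/
def symEmbedding (m : ℕ) : Matrix (Fin m → Fin 2) (Fin (m + 1)) ℂ :=
  Matrix.of fun σ j =>
    if (Finset.univ.filter fun i => σ i = 1).card = (j : ℕ) then
      (((Real.sqrt (m.choose (j : ℕ) : ℝ))⁻¹ : ℝ) : ℂ)
    else 0

/-- `W^{(m)}`: the restriction of `W ⊗ ⋯ ⊗ W` (`m` factors) to the symmetric tensors. -/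
def symPower (m : ℕ) (W : Matrix (Fin 2) (Fin 2) ℂ) : Matrix (Fin (m + 1)) (Fin (m + 1)) ℂ :=
  (symEmbedding m)ᵀ * (Matrix.of fun σ τ : Fin m → Fin 2 => ∏ i, W (σ i) (τ i)) * symEmbedding m

/-- `𝒲 = ⨂ₙ W^{(2sₙ)}`. -/
def globalTwist {N : ℕ} (ℓ : Fin N → ℕ) (W : Matrix (Fin 2) (Fin 2) ℂ) : Op ℓ :=
  tensorOp ℓ fun n => symPower (ℓ n) W

/-- The points `ξₙ^{(k)} = ξₙ - η/2 + (sₙ - k) η`. -/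
def point {N : ℕ} (ℓ : Fin N → ℕ) (η : ℂ) (ξ : Fin N → ℂ) (n : Fin N) (k : ℕ) : ℂ :=
  ξ n - η / 2 + ((ℓ n : ℂ) / 2 - (k : ℂ)) * η

/-- `a(x) = ∏ₙ (x - ξₙ + η/2 + sₙ η)`. -/
def aFun {N : ℕ} (ℓ : Fin N → ℕ) (η : ℂ) (ξ : Fin N → ℂ) (x : ℂ) : ℂ :=
  ∏ n, (x - (ξ n - η / 2) + (ℓ n : ℂ) / 2 * η)

/-- `d(x) = ∏ₙ (x - ξₙ + η/2 - sₙ η)`. -/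
def dFun {N : ℕ} (ℓ : Fin N → ℕ) (η : ℂ) (ξ : Fin N → ℂ) (x : ℂ) : ℂ :=
  ∏ n, (x - (ξ n - η / 2) - (ℓ n : ℂ) / 2 * η)

/-- `f (k + 1)`, with `f` extended by zero outside `{0, …, m}`. -/
def up {m : ℕ} {V : Type} [Zero V] (f : Fin (m + 1) → V) (k : Fin (m + 1)) : V :=
  if hk : (k : ℕ) + 1 < m + 1 then f ⟨(k : ℕ) + 1, hk⟩ else 0

/-- `f (k - 1)`, with `f` extended by zero outside `{0, …, m}`. -/
def down {m : ℕ} {V : Type} [Zero V] (f : Fin (m + 1) → V) (k : Fin (m + 1)) : V :=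
  if (k : ℕ) = 0 then 0 else f ⟨(k : ℕ) - 1, by omega⟩

/-- The one-parameter family `X(x)` is (simultaneously) diagonalizable with simple spectrum: there
is a basis of common eigenvectors, and different basis vectors have different eigenvalue
functions `x ↦ d i x`. -/
def DiagonalizableSimple {ι : Type} [Fintype ι] (X : ℂ → Matrix ι ι ℂ) : Prop :=
  ∃ (v : Module.Basis ι ℂ (ι → ℂ)) (d : ι → ℂ → ℂ),
    Function.Injective d ∧ ∀ i x, X x *ᵥ v i = d i x • v i

/-- The covector basis `v = (⟨h|)` and the operators `Y n` form a separation of variables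
representation of Sklyanin's type of the spectral problem of `T^{(K)}`, generated by the operator
zeros of `X(x) = β ∏ₙ (x - Yₙ)` and with shift operators given by `R` (raising) and `L`
(lowering). -/
structure IsSoVRepresentation {N : ℕ} (ℓ : Fin N → ℕ) (η : ℂ) (ξ : Fin N → ℂ)
    (K : Matrix (Fin 2) (Fin 2) ℂ) (κ₁ κ₂ β : ℂ) (X R L : ℂ → Op ℓ)
    (v : Module.Basis (State ℓ) ℂ (State ℓ → ℂ)) (Y : Fin N → Op ℓ) : Prop where
  /-- The separate variables commute. -/
  commute : ∀ m n, Commute (Y m) (Y n)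
  /-- The separate variables are the operator zeros of `X`. -/
  zeros : ∀ x, X x = β • (List.ofFn fun n => x • (1 : Op ℓ) - Y n).prod
  /-- The separate variables are diagonal in the basis, with `⟨h| Yₙ = ξₙ^{(hₙ)} ⟨h|`. -/
  eigen : ∀ h n, v h ᵥ* Y n = point ℓ η ξ n (h n) • v h
  /-- On `⟨h|`, `R` evaluated at the separate variable `n` shifts `hₙ` to `hₙ + 1`. -/
  raising : ∀ h n, v h ᵥ* R (point ℓ η ξ n (h n)) =
    (κ₁ * aFun ℓ η ξ (point ℓ η ξ n (h n))) • up (fun k => v (Function.update h n k)) (h n)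
  /-- On `⟨h|`, `L` evaluated at the separate variable `n` shifts `hₙ` to `hₙ - 1`. -/
  lowering : ∀ h n, v h ᵥ* L (point ℓ η ξ n (h n)) =
    (κ₂ * dFun ℓ η ξ (point ℓ η ξ n (h n))) • down (fun k => v (Function.update h n k)) (h n)
  /-- The transfer matrix is the sum of the two shift families. -/
  transfer_eq : ∀ x, transfer ℓ η ξ K x = R x + L x
  /-- The spectral problem of the transfer matrix separates: a nonzero vector is a common
  eigenvector with eigenvalue `t(x)` exactly when `t` is a polynomial of degree at most `N` with
  `x^N`-coefficient `tr K`, and its wave function in the basis is a product of functions of one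
  variable, each of which solves a second order difference equation in that variable. -/
  separation : ∀ (t : ℂ → ℂ) (ψ : State ℓ → ℂ), ψ ≠ 0 →
    ((∀ x, transfer ℓ η ξ K x *ᵥ ψ = t x • ψ) ↔
      (∃ p : Polynomial ℂ, p.natDegree ≤ N ∧ p.coeff N = K.trace ∧ ∀ x, t x = p.eval x) ∧
      ∃ (c : ℂ) (Q : ∀ n : Fin N, Fin (ℓ n + 1) → ℂ),
        (∀ h, v h ⬝ᵥ ψ = c * ∏ n, Q n (h n)) ∧
        ∀ (n : Fin N) (k : Fin (ℓ n + 1)), t (point ℓ η ξ n k) * Q n k =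
          κ₁ * aFun ℓ η ξ (point ℓ η ξ n k) * up (Q n) k +
          κ₂ * dFun ℓ η ξ (point ℓ η ξ n k) * down (Q n) k)

/-- Existence of the representation above, for every splitting `κ₁ κ₂ = det K` with `κ₁ ≠ 0` (for
invertible `K`, for instance, the two eigenvalues of `K`; in general `κ₁ = 1`, `κ₂ = det K`);
the splitting only fixes the normalization of the basis. -/
def AdmitsSoV {N : ℕ} (ℓ : Fin N → ℕ) (η : ℂ) (ξ : Fin N → ℂ)
    (K : Matrix (Fin 2) (Fin 2) ℂ) (β : ℂ) (X R L : ℂ → Op ℓ) : Prop :=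
  ∀ κ₁ κ₂ : ℂ, κ₁ ≠ 0 → κ₁ * κ₂ = K.det →
    ∃ (v : Module.Basis (State ℓ) ℂ (State ℓ → ℂ)) (Y : Fin N → Op ℓ),
      IsSoVRepresentation ℓ η ξ K κ₁ κ₂ β X R L v Y

end HigherSpin

end

/-! The theorem reduces to one case, `K 0 1 ≠ 0` with `X = B`, which is carried to the others by a
change of basis of `ℂ²`.

The monodromy matrix satisfies the quadratic Yang–Baxter relations and the quantum determinant
identity `A(c) D(c-η) - B(c) C(c-η) = det K · a(c) d(c-η)`. Both hold for a single Lax matrix, by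
the spin commutation relations and the Casimir, and pass to products of matrices whose entries
commute with each other (`YangBaxter.mul`, `HasQuantumDet.mul`).

The covector `⟨0, …, 0|` is an eigencovector of `B(x)` with eigenvalue `b d(x)`. If a covector has
`B`-eigenvalue `(x - c) r(x)`, then applying `A(c)` moves the zero `c` to `c - η`
(`YangBaxter.shift_zero`). Since the operators `A` commute, repeated application to the vacuum gives
covectors labelled by `h`, with eigenvalue `b ∏ₙ (x - ξₙ^{(hₙ)})`. The crux is that they do not
vanish. The quantum determinant shows this when `det K ≠ 0`; in general, `A` and `B` see only the
first row of `K`, so the second row may be replaced to make the determinant equal to `b`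
(`raise_ne_zero`). Genericity of the `ξₙ` separates the eigenvalues, so these covectors form a basis
(`exists_covectorBasis`). Beyond the edges of the box, a shifted covector would be annihilated by
some `B(y)` whose eigenvalues are all nonzero, so it is zero. Inside the box, the quantum
determinant turns the action of `A` into that of `D` (`lowering_of_raising`).

At `x = ξₙ^{(hₙ)}` the transfer matrix thus acts by a three-term relation in `hₙ` alone. As `κ₁ a`
does not vanish below the top label, a solution is fixed by its value at `0`, and the wave function
factorizes. Conversely, `T(x)ψ - t(x)ψ` tested on `⟨h|` is a polynomial of degree below `N` with `N`
distinct zeros (`separation_of_action`).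

For a general `W`, the spin operators are the derived action of `gl₂` on symmetric tensors, so `W₀𝒲`
commutes with every Lax matrix (`commute_twist_lax`), and the rotated operators are the entries for
the twist `W⁻¹KW`, conjugated by `𝒲` (`rotated_eq`). Exchanging the two basis vectors of `ℂ²` turns
`B` into `C`. -/

noncomputable section

namespace HigherSpin

/-! ### Matrices with mutually commuting entries -/

section EntriesCommute

variable {R : Type*} [Ring R]

/-- All entries of `M` commute with all entries of `M'`. -/
def EntriesCommute (M M' : ℂ → Matrix (Fin 2) (Fin 2) R) : Prop :=
  ∀ x y i j k l, Commute (M x i j) (M' y k l)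

theorem EntriesCommute.mul_right {M L L' : ℂ → Matrix (Fin 2) (Fin 2) R}
    (h : EntriesCommute M L) (h' : EntriesCommute M L') :
    EntriesCommute M fun x => L x * L' x := by
  intro x y i j k l
  simp only [Matrix.mul_apply]
  exact Commute.sum_right _ _ _ fun p _ => (h x y i j k p).mul_right (h' x y i j p l)

theorem entriesCommute_list_prod {ι : Type*} {L : ι → ℂ → Matrix (Fin 2) (Fin 2) R}
    {M : ℂ → Matrix (Fin 2) (Fin 2) R} :
    ∀ is : List ι, (∀ i ∈ is, EntriesCommute M (L i)) →
      EntriesCommute M fun x => (is.map fun i => L i x).prod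
  | [], _ => by
    intro x y i j k l
    simp only [List.map_nil, List.prod_nil, Matrix.one_apply]
    split_ifs <;> simp
  | i :: is, h => by
    simp only [List.map_cons, List.prod_cons]
    exact (h i (by simp)).mul_right
      (entriesCommute_list_prod is fun j hj => h j (List.mem_cons_of_mem _ hj))

end EntriesCommute

/-! ### The Yang–Baxter algebra and the quantum determinant -/

section Algebra

variable {R : Type*} [Ring R] [Algebra ℂ R]

/-- The quadratic relations of the rational `6`-vertex Yang–Baxter algebra, in components. -/
def YangBaxter (η : ℂ) (M : ℂ → Matrix (Fin 2) (Fin 2) R) : Prop :=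
  ∀ x y i j k l, (x - y) • (M x i j * M y k l - M y k l * M x i j) =
    η • (M y k j * M x i l - M x k j * M y i l)

/-- The columns of `M` are `q`-antisymmetric, with quantum determinant `Δ`. -/
def HasQuantumDet (η : ℂ) (Δ : ℂ → ℂ) (M : ℂ → Matrix (Fin 2) (Fin 2) R) : Prop :=
  ∀ x i k, M x i 0 * M (x - η) k 1 - M x i 1 * M (x - η) k 0 =
    (Δ x * (!![0, 1; -1, 0] : Matrix (Fin 2) (Fin 2) ℂ) i k) • (1 : R)

/-- For fixed inner indices `p`, `q` the relation for `M` is used on the left factors and that for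
`L` on the right ones. After summation, the first exchange term of `M` and the second of `L` cancel
under `p ↔ q`; the other two are the exchange terms of the product. -/
theorem YangBaxter.mul {η : ℂ} {M L : ℂ → Matrix (Fin 2) (Fin 2) R} (hM : YangBaxter η M)
    (hL : YangBaxter η L) (hc : EntriesCommute M L) : YangBaxter η fun x => M x * L x := by
  intro x y i j k l
  have e : ∀ u v (i j k l p q : Fin 2), M u i p * L u p j * (M v k q * L v q l) =
      M u i p * M v k q * (L u p j * L v q l) := fun u v i j k l p q =>
    (hc v u k q p j).symm.mul_mul_mul_comm _ _
  have key : ∀ p q : Fin 2,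
      (x - y) • (M x i p * L x p j * (M y k q * L y q l) -
        M y k q * L y q l * (M x i p * L x p j)) =
      η • (M y k p * M x i q * (L x p j * L y q l) - M x k p * M y i q * (L x p j * L y q l)) +
      η • (M y k q * M x i p * (L y q j * L x p l) - M y k q * M x i p * (L x q j * L y p l)) := by
    intro p q
    have h1 := congrArg (· * (L x p j * L y q l)) (hM x y i p k q)
    have h2 := congrArg (M y k q * M x i p * ·) (hL x y p j q l)
    simp only [smul_mul_assoc, mul_smul_comm, sub_mul, mul_sub] at h1 h2
    rw [e, e, ← h1, ← h2, ← smul_add]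
    congr 1
    abel
  simp only [Matrix.mul_apply, Fin.sum_univ_two, add_mul, mul_add]
  have k00 := key 0 0
  have k01 := key 0 1
  have k10 := key 1 0
  have k11 := key 1 1
  simp only [e] at k00 k01 k10 k11 ⊢
  linear_combination (norm := module) k00 + k01 + k10 + k11

/-- The relation for `L` contracts its columns to `Δ' ε_{pq}`; contracting the rows of `M` with
`ε_{pq}` is then the relation for `M`. -/
theorem HasQuantumDet.mul {η : ℂ} {Δ Δ' : ℂ → ℂ} {M L : ℂ → Matrix (Fin 2) (Fin 2) R}
    (hM : HasQuantumDet η Δ M) (hL : HasQuantumDet η Δ' L) (hc : EntriesCommute M L) :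
    HasQuantumDet η (fun x => Δ x * Δ' x) fun x => M x * L x := by
  intro x i k
  have e : ∀ u v (i j k l p q : Fin 2), M u i p * L u p j * (M v k q * L v q l) =
      M u i p * M v k q * (L u p j * L v q l) := fun u v i j k l p q =>
    (hc v u k q p j).symm.mul_mul_mul_comm _ _
  have key : ∀ p q : Fin 2,
      M x i p * M (x - η) k q * (L x p 0 * L (x - η) q 1) -
        M x i p * M (x - η) k q * (L x p 1 * L (x - η) q 0) =
      (Δ' x * (!![0, 1; -1, 0] : Matrix (Fin 2) (Fin 2) ℂ) p q) •
        (M x i p * M (x - η) k q) := by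
    intro p q
    rw [← mul_sub, hL, mul_smul_comm, mul_one]
  simp only [Matrix.mul_apply, Fin.sum_univ_two, add_mul, mul_add, e]
  have k00 := key 0 0
  have k01 := key 0 1
  have k10 := key 1 0
  have k11 := key 1 1
  have h := hM x i k
  simp only [Matrix.of_apply, Matrix.cons_val', Matrix.cons_val_zero, Matrix.cons_val_one,
    Matrix.cons_val_fin_one] at k00 k01 k10 k11
  linear_combination (norm := module) k00 + k01 + k10 + k11 + Δ' x • h

/-- The `2 × 2` Lax matrix built from a triple `Z`, `U`, `D`. -/
def laxMatrix (η : ℂ) (Z U D : R) (x : ℂ) : Matrix (Fin 2) (Fin 2) R :=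
  !![(x + η / 2) • (1 : R) + η • Z, η • D; η • U, (x + η / 2) • (1 : R) - η • Z]

/-- The commutation rules bring every product into the order `Z`, `D`, `U`, after which each
component is a linear identity. -/
theorem yangBaxter_laxMatrix {η : ℂ} {Z U D : R} (hU : U * Z = Z * U - U)
    (hD : D * Z = Z * D + D) (hUD : U * D = D * U + (2 : ℂ) • Z) :
    YangBaxter η (laxMatrix η Z U D) := by
  intro x y i j k l
  fin_cases i <;> fin_cases j <;> fin_cases k <;> fin_cases l <;>
    simp only [laxMatrix, Fin.zero_eta, Fin.mk_one, Matrix.of_apply, Matrix.cons_val',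
      Matrix.cons_val_zero,
      Matrix.cons_val_one, Matrix.cons_val_fin_one, mul_add, add_mul, sub_mul, mul_sub,
      smul_mul_assoc, mul_smul_comm, mul_one, one_mul, hU, hD, hUD] <;> module

/-- Normal ordering leaves only `D * U`, which the Casimir relation of spin `m / 2` removes. -/
theorem hasQuantumDet_laxMatrix {η m : ℂ} {Z U D : R} (hU : U * Z = Z * U - U)
    (hD : D * Z = Z * D + D) (hUD : U * D = D * U + (2 : ℂ) • Z)
    (hC : D * U = (m / 2 * (m / 2 + 1)) • (1 : R) - Z - Z * Z) :
    HasQuantumDet η (fun x => (x + η / 2 + m / 2 * η) * (x - η + η / 2 - m / 2 * η))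
      (laxMatrix η Z U D) := by
  intro x i k
  fin_cases i <;> fin_cases k <;>
    simp only [laxMatrix, Fin.zero_eta, Fin.mk_one, Matrix.of_apply, Matrix.cons_val',
      Matrix.cons_val_zero,
      Matrix.cons_val_one, Matrix.cons_val_fin_one, mul_add, add_mul, sub_mul, mul_sub,
      smul_mul_assoc, mul_smul_comm, mul_one, one_mul, hU, hD, hUD, hC] <;> module

theorem yangBaxter_one (η : ℂ) : YangBaxter η fun _ => (1 : Matrix (Fin 2) (Fin 2) R) := by
  intro x y i j k l
  fin_cases i <;> fin_cases j <;> fin_cases k <;> fin_cases l <;> simp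

theorem hasQuantumDet_one (η : ℂ) :
    HasQuantumDet η (fun _ => 1) fun _ => (1 : Matrix (Fin 2) (Fin 2) R) := by
  intro x
  simp [Fin.forall_fin_two]

theorem yangBaxter_const (η : ℂ) (K : Matrix (Fin 2) (Fin 2) ℂ) :
    YangBaxter η fun _ => K.map fun z => z • (1 : R) := by
  intro x y i j k l
  simp only [Matrix.map_apply, smul_mul_smul_comm, mul_one]
  module

theorem hasQuantumDet_const (η : ℂ) (K : Matrix (Fin 2) (Fin 2) ℂ) :
    HasQuantumDet η (fun _ => K.det) fun _ => K.map fun z => z • (1 : R) := by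
  intro x i k
  fin_cases i <;> fin_cases k <;>
    simp only [Fin.zero_eta, Fin.mk_one, Matrix.map_apply, Matrix.det_fin_two, Matrix.of_apply,
      Matrix.cons_val', Matrix.cons_val_zero, Matrix.cons_val_one, Matrix.cons_val_fin_one,
      smul_mul_smul_comm, mul_one] <;> module

theorem entriesCommute_const (K : Matrix (Fin 2) (Fin 2) ℂ) (M : ℂ → Matrix (Fin 2) (Fin 2) R) :
    EntriesCommute (fun _ => K.map fun z => z • (1 : R)) M := by
  intro x y i j k l
  exact (Commute.one_left _).smul_left _

section List

variable {ι : Type*} {L : ι → ℂ → Matrix (Fin 2) (Fin 2) R}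

/-- Distinct indices supply the commuting entries required by `YangBaxter.mul`; the entries of a
single `L i` need not commute. -/
theorem yangBaxter_list_prod {η : ℂ} (hL : ∀ i, YangBaxter η (L i))
    (hc : ∀ i j, i ≠ j → EntriesCommute (L i) (L j)) :
    ∀ is : List ι, is.Nodup → YangBaxter η fun x => (is.map fun i => L i x).prod
  | [], _ => by simpa using yangBaxter_one η
  | i :: is, h => by
    rw [List.nodup_cons] at h
    simp only [List.map_cons, List.prod_cons]
    exact (hL i).mul (yangBaxter_list_prod hL hc is h.2)
      (entriesCommute_list_prod is fun j hj => hc i j fun e => h.1 (e ▸ hj))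

theorem hasQuantumDet_list_prod {η : ℂ} {Δ : ι → ℂ → ℂ} (hL : ∀ i, HasQuantumDet η (Δ i) (L i))
    (hc : ∀ i j, i ≠ j → EntriesCommute (L i) (L j)) :
    ∀ is : List ι, is.Nodup → HasQuantumDet η (fun x => (is.map fun i => Δ i x).prod)
      fun x => (is.map fun i => L i x).prod
  | [], _ => by simpa using hasQuantumDet_one η
  | i :: is, h => by
    rw [List.nodup_cons] at h
    simp only [List.map_cons, List.prod_cons]
    exact (hL i).mul (hasQuantumDet_list_prod hL hc is h.2)
      (entriesCommute_list_prod is fun j hj => hc i j fun e => h.1 (e ▸ hj))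

end List

end Algebra

/-! ### Operators on the tensor product of the sites -/

section Sites

variable {N : ℕ} (ℓ : Fin N → ℕ)

theorem tensorOp_mul (A B : ∀ n : Fin N, Matrix (Fin (ℓ n + 1)) (Fin (ℓ n + 1)) ℂ) :
    tensorOp ℓ A * tensorOp ℓ B = tensorOp ℓ fun n => A n * B n := by
  ext g h
  simp only [tensorOp, Matrix.mul_apply, Matrix.of_apply, ← Finset.prod_mul_distrib]
  rw [Finset.prod_univ_sum, Fintype.piFinset_univ]

theorem tensorOp_one : tensorOp ℓ (fun _ => 1) = 1 := by
  ext g h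
  simp only [tensorOp, Matrix.of_apply, Matrix.one_apply]
  rw [Finset.prod_ite_zero]
  simp [funext_iff]

/-- Isolating the factor of site `n` exhibits linearity in `A`. -/
theorem siteOp_apply (n : Fin N) (A : Matrix (Fin (ℓ n + 1)) (Fin (ℓ n + 1)) ℂ) (g h : State ℓ) :
    siteOp ℓ n A g h = A (g n) (h n) * ∏ m ∈ Finset.univ.erase n,
      (1 : Matrix (Fin (ℓ m + 1)) (Fin (ℓ m + 1)) ℂ) (g m) (h m) := by
  rw [siteOp, tensorOp, Matrix.of_apply, ← Finset.mul_prod_erase _ _ (Finset.mem_univ n)]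
  congr 1
  · simp
  · refine Finset.prod_congr rfl fun m hm => ?_
    rw [Function.update_of_ne (Finset.ne_of_mem_erase hm)]

/-- `siteOp` as a homomorphism of algebras. -/
def siteHom (n : Fin N) : Matrix (Fin (ℓ n + 1)) (Fin (ℓ n + 1)) ℂ →ₐ[ℂ] Op ℓ :=
  AlgHom.ofLinearMap
    { toFun := siteOp ℓ n
      map_add' := fun A B => by
        ext g h
        simp [siteOp_apply, add_mul]
      map_smul' := fun c A => by
        ext g h
        simp [siteOp_apply, mul_assoc] }
    (by simp [siteOp, tensorOp_one])
    (fun A B => by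
      simp only [LinearMap.coe_mk, AddHom.coe_mk, siteOp, tensorOp_mul]
      congr 1
      ext1 m
      rcases eq_or_ne m n with rfl | hm
      · simp
      · simp [Function.update_of_ne hm])

theorem siteHom_apply (n : Fin N) (A : Matrix (Fin (ℓ n + 1)) (Fin (ℓ n + 1)) ℂ) :
    siteHom ℓ n A = siteOp ℓ n A := rfl

theorem commute_siteOp {m n : Fin N} (hmn : m ≠ n) (A : Matrix (Fin (ℓ m + 1)) (Fin (ℓ m + 1)) ℂ)
    (B : Matrix (Fin (ℓ n + 1)) (Fin (ℓ n + 1)) ℂ) : Commute (siteOp ℓ m A) (siteOp ℓ n B) := by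
  simp only [commute_iff_eq, siteOp, tensorOp_mul]
  congr 1
  ext1 k
  rcases eq_or_ne k m with rfl | hm
  · simp [Function.update_of_ne hmn]
  · simp [Function.update_of_ne hm]

end Sites

/-! ### Spin operators and their commutation relations -/

section Spin

variable (m : ℕ)

theorem spinUp_apply (i j : Fin (m + 1)) : spinUp m i j = if (i : ℕ) + 1 = j then
    ((Real.sqrt ((((i : ℕ) : ℝ) + 1) * ((m : ℝ) - ((i : ℕ) : ℝ))) : ℝ) : ℂ) else 0 := rfl

theorem ofReal_sqrt_mul_self {r : ℝ} (hr : 0 ≤ r) :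
    ((Real.sqrt r : ℝ) : ℂ) * (Real.sqrt r : ℝ) = r := by
  rw [← Complex.ofReal_mul, Real.mul_self_sqrt hr]

theorem spinUp_mul_spinDown : spinUp m * spinDown m =
    Matrix.diagonal fun i : Fin (m + 1) => (((i : ℕ) : ℂ) + 1) * ((m : ℂ) - ((i : ℕ) : ℂ)) := by
  ext i j
  have hi : ((i : ℕ) : ℝ) ≤ m := by exact_mod_cast Nat.lt_succ_iff.mp i.2
  simp only [spinDown, Matrix.mul_apply, Matrix.transpose_apply, spinUp_apply,
    Matrix.diagonal_apply]
  -- The last row of `S^+` is zero, and so is `(i + 1) (m - i)` at `i = m`.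
  by_cases h : (i : ℕ) = m
  · simp [h]
  · rw [Finset.sum_eq_single (⟨i + 1, by omega⟩ : Fin (m + 1))]
    · by_cases hij : i = j
      · subst hij
        simp only [if_true]
        rw [ofReal_sqrt_mul_self (mul_nonneg (by positivity) (by linarith))]
        push_cast; ring
      · have : ¬ ((j : ℕ) = i) := fun e => hij (Fin.ext e.symm)
        simp [hij, this]
    · intro k _ hk
      rw [if_neg fun e => hk (Fin.ext e.symm), zero_mul]
    · simp

theorem spinDown_mul_spinUp : spinDown m * spinUp m =
    Matrix.diagonal fun i : Fin (m + 1) => ((i : ℕ) : ℂ) * ((m : ℂ) - ((i : ℕ) : ℂ) + 1) := by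
  ext i j
  have hi : ((i : ℕ) : ℝ) ≤ m := by exact_mod_cast Nat.lt_succ_iff.mp i.2
  simp only [spinDown, Matrix.mul_apply, Matrix.transpose_apply, spinUp_apply,
    Matrix.diagonal_apply]
  by_cases h : (i : ℕ) = 0
  · simp [h]
  · obtain ⟨p, hp⟩ := Nat.exists_eq_succ_of_ne_zero h
    rw [Finset.sum_eq_single (⟨p, by omega⟩ : Fin (m + 1))]
    · have hp' : ((i : ℕ) : ℝ) = p + 1 := by rw [hp]; push_cast; rfl
      have hpc : ((i : ℕ) : ℂ) = p + 1 := by rw [hp]; push_cast; rfl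
      by_cases hij : i = j
      · subst hij
        simp only [hp, Nat.succ_eq_add_one, if_true]
        rw [ofReal_sqrt_mul_self (mul_nonneg (by positivity) (by linarith))]
        push_cast; ring
      · have : ¬ (p + 1 = (j : ℕ)) := fun e => hij (Fin.ext (by omega))
        simp [hij, this]
    · intro k _ hk
      rw [if_neg fun e => hk (Fin.ext (by simp only; omega)), zero_mul]
    · simp

theorem spinUp_mul_spinZ : spinUp m * spinZ m = spinZ m * spinUp m - spinUp m := by
  ext i j
  simp only [spinZ, Matrix.mul_diagonal, Matrix.diagonal_mul, Matrix.sub_apply, spinUp_apply]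
  split_ifs with h
  · rw [← h]; push_cast; ring
  · simp

theorem spinDown_mul_spinZ : spinDown m * spinZ m = spinZ m * spinDown m + spinDown m := by
  have h := congrArg Matrix.transpose (spinUp_mul_spinZ m)
  simp only [Matrix.transpose_mul, Matrix.transpose_sub, spinZ, Matrix.diagonal_transpose] at h
  rw [spinDown, spinZ, h]
  abel

theorem spinUp_mul_spinDown_comm :
    spinUp m * spinDown m = spinDown m * spinUp m + (2 : ℂ) • spinZ m := by
  rw [spinUp_mul_spinDown, spinDown_mul_spinUp, spinZ, ← Matrix.diagonal_smul,
    Matrix.diagonal_add]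
  congr 1
  ext i
  simp only [Pi.smul_apply, smul_eq_mul]
  ring

theorem spin_casimir : spinDown m * spinUp m =
    ((m : ℂ) / 2 * ((m : ℂ) / 2 + 1)) • (1 : Matrix (Fin (m + 1)) (Fin (m + 1)) ℂ) - spinZ m -
      spinZ m * spinZ m := by
  rw [spinDown_mul_spinUp, spinZ, ← Matrix.diagonal_one, ← Matrix.diagonal_smul,
    Matrix.diagonal_mul_diagonal, Matrix.diagonal_sub, Matrix.diagonal_sub]
  congr 1
  ext i
  simp only [Pi.smul_apply, smul_eq_mul]
  ring

end Spin

/-! ### The monodromy matrix and its reference covector -/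

section Monodromy

variable {N : ℕ} (ℓ : Fin N → ℕ) (η : ℂ) (ξ : Fin N → ℂ) (K : Matrix (Fin 2) (Fin 2) ℂ)

theorem lax_eq_laxMatrix (n : Fin N) : lax ℓ η n =
    laxMatrix η (siteOp ℓ n (spinZ (ℓ n))) (siteOp ℓ n (spinUp (ℓ n)))
      (siteOp ℓ n (spinDown (ℓ n))) := rfl

theorem yangBaxter_lax (n : Fin N) : YangBaxter η (lax ℓ η n) := by
  rw [lax_eq_laxMatrix]
  simp only [← siteHom_apply]
  apply yangBaxter_laxMatrix
  · rw [← map_mul, spinUp_mul_spinZ, map_sub, map_mul]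
  · rw [← map_mul, spinDown_mul_spinZ, map_add, map_mul]
  · rw [← map_mul, spinUp_mul_spinDown_comm, map_add, map_mul, map_smul]

theorem hasQuantumDet_lax (n : Fin N) : HasQuantumDet η
    (fun x => (x + η / 2 + (ℓ n : ℂ) / 2 * η) * (x - η + η / 2 - (ℓ n : ℂ) / 2 * η))
    (lax ℓ η n) := by
  rw [lax_eq_laxMatrix]
  simp only [← siteHom_apply]
  apply hasQuantumDet_laxMatrix
  · rw [← map_mul, spinUp_mul_spinZ, map_sub, map_mul]
  · rw [← map_mul, spinDown_mul_spinZ, map_add, map_mul]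
  · rw [← map_mul, spinUp_mul_spinDown_comm, map_add, map_mul, map_smul]
  · rw [← map_mul, spin_casimir, map_sub, map_sub, map_mul, map_smul, map_one]

/-- Locality of the entries is what makes Lax matrices of different sites commute. -/
theorem lax_mem (n : Fin N) (x : ℂ) (i j : Fin 2) :
    ∃ A : Matrix (Fin (ℓ n + 1)) (Fin (ℓ n + 1)) ℂ, lax ℓ η n x i j = siteOp ℓ n A := by
  simp only [lax_eq_laxMatrix, ← siteHom_apply]
  revert i j
  simp only [Fin.forall_fin_two, laxMatrix, Matrix.of_apply, Matrix.cons_val',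
    Matrix.cons_val_zero, Matrix.cons_val_one, Matrix.cons_val_fin_one]
  refine ⟨⟨⟨(x + η / 2) • 1 + η • spinZ (ℓ n), ?_⟩, ⟨η • spinDown (ℓ n), ?_⟩⟩,
    ⟨η • spinUp (ℓ n), ?_⟩, ⟨(x + η / 2) • 1 - η • spinZ (ℓ n), ?_⟩⟩ <;> simp

theorem entriesCommute_lax {m n : Fin N} (hmn : m ≠ n) (u v : ℂ) :
    EntriesCommute (fun x => lax ℓ η m (x - u)) (fun x => lax ℓ η n (x - v)) := by
  intro x y i j k l
  obtain ⟨A, hA⟩ := lax_mem ℓ η m (x - u) i j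
  obtain ⟨B, hB⟩ := lax_mem ℓ η n (y - v) k l
  simpa only [hA, hB] using commute_siteOp ℓ hmn A B

theorem monodromy_eq (x : ℂ) : monodromy ℓ η ξ K x = (K.map fun z => z • (1 : Op ℓ)) *
    ((List.finRange N).reverse.map fun n => lax ℓ η n (x - ξ n)).prod := by
  rw [monodromy, aux, List.ofFn_eq_map, List.map_reverse]

theorem yangBaxter_monodromy : YangBaxter η (monodromy ℓ η ξ K) := by
  have h : monodromy ℓ η ξ K = fun x => (K.map fun z => z • (1 : Op ℓ)) *
    ((List.finRange N).reverse.map fun n => lax ℓ η n (x - ξ n)).prod :=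
      funext (monodromy_eq ℓ η ξ K)
  rw [h]
  refine (yangBaxter_const η K).mul (yangBaxter_list_prod (L := fun n x => lax ℓ η n (x - ξ n))
    (fun n x y i j k l => ?_) (fun m n hmn => entriesCommute_lax ℓ η hmn _ _) _
    (List.nodup_reverse.mpr (List.nodup_finRange N))) (entriesCommute_const K _)
  simpa using yangBaxter_lax ℓ η n (x - ξ n) (y - ξ n) i j k l

theorem hasQuantumDet_monodromy : HasQuantumDet η
    (fun x => K.det * (aFun ℓ η ξ x * dFun ℓ η ξ (x - η))) (monodromy ℓ η ξ K) := by
  have h : monodromy ℓ η ξ K = fun x => (K.map fun z => z • (1 : Op ℓ)) *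
    ((List.finRange N).reverse.map fun n => lax ℓ η n (x - ξ n)).prod :=
      funext (monodromy_eq ℓ η ξ K)
  have h2 : (fun x => aFun ℓ η ξ x * dFun ℓ η ξ (x - η)) = fun x =>
      ((List.finRange N).reverse.map fun n => (x - ξ n + η / 2 + (ℓ n : ℂ) / 2 * η) *
        (x - ξ n - η + η / 2 - (ℓ n : ℂ) / 2 * η)).prod := by
    ext x
    rw [List.map_reverse, List.prod_reverse, ← List.ofFn_eq_map, List.prod_ofFn, aFun, dFun,
      ← Finset.prod_mul_distrib]
    exact Finset.prod_congr rfl fun n _ => by ring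
  have h3 : (fun x => K.det * (aFun ℓ η ξ x * dFun ℓ η ξ (x - η))) = fun x => K.det *
      ((fun x => aFun ℓ η ξ x * dFun ℓ η ξ (x - η)) x) := rfl
  rw [h, h3, h2]
  refine (hasQuantumDet_const η K).mul (hasQuantumDet_list_prod
    (L := fun n x => lax ℓ η n (x - ξ n)) (fun n x i k => ?_)
    (fun m n hmn => entriesCommute_lax ℓ η hmn _ _) _
    (List.nodup_reverse.mpr (List.nodup_finRange N))) (entriesCommute_const K _)
  simpa [sub_right_comm] using hasQuantumDet_lax ℓ η n (x - ξ n) i k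

/-- The covector `⟨0, …, 0|`. -/
def vacuum : State ℓ → ℂ := Pi.single 0 1

theorem vacuum_vecMul_siteOp {n : Fin N} {A : Matrix (Fin (ℓ n + 1)) (Fin (ℓ n + 1)) ℂ} {c : ℂ}
    (hA : ∀ j, A 0 j = c * (1 : Matrix (Fin (ℓ n + 1)) (Fin (ℓ n + 1)) ℂ) 0 j) :
    vacuum ℓ ᵥ* siteOp ℓ n A = c • vacuum ℓ := by
  have h : vacuum ℓ ᵥ* siteOp ℓ n A = c • vacuum ℓ ᵥ* siteOp ℓ n 1 := by
    ext h
    simp only [vacuum, Matrix.single_one_vecMul, Matrix.row_apply, siteOp_apply, Pi.zero_apply, hA,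
      Pi.smul_apply, smul_eq_mul, mul_assoc]
    rfl
  rw [h, ← siteHom_apply, map_one, Matrix.vecMul_one]

theorem vacuum_vecMul_lax_one_one (n : Fin N) (x : ℂ) : vacuum ℓ ᵥ* lax ℓ η n x 1 1 =
    (x + η / 2 - (ℓ n : ℂ) / 2 * η) • vacuum ℓ := by
  have h : vacuum ℓ ᵥ* siteOp ℓ n (spinZ (ℓ n)) = ((ℓ n : ℂ) / 2) • vacuum ℓ := by
    apply vacuum_vecMul_siteOp
    intro j
    by_cases hj : j = 0
    · subst hj; simp [spinZ]
    · simp [spinZ, Ne.symm hj]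
  simp only [lax, Matrix.of_apply, Matrix.cons_val', Matrix.cons_val_one,
    Matrix.cons_val_fin_one, Matrix.vecMul_sub, Matrix.vecMul_smul, Matrix.vecMul_one, h]
  module

theorem vacuum_vecMul_lax_zero_one (n : Fin N) (x : ℂ) : vacuum ℓ ᵥ* lax ℓ η n x 0 1 = 0 := by
  have h : vacuum ℓ ᵥ* siteOp ℓ n (spinDown (ℓ n)) = (0 : ℂ) • vacuum ℓ := by
    apply vacuum_vecMul_siteOp
    intro j
    simp [spinDown, spinUp_apply]
  simp [lax, Matrix.vecMul_smul, h]

/-- On the vacuum covector each Lax matrix is triangular, because row `0` of `S^-` is zero.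
Commuting entries allow the tail of the product to act first. -/
theorem vacuum_vecMul_lax_prod (x : ℂ) : ∀ is : List (Fin N), is.Nodup →
    vacuum ℓ ᵥ* (is.map fun n => lax ℓ η n (x - ξ n)).prod 0 1 = 0 ∧
    vacuum ℓ ᵥ* (is.map fun n => lax ℓ η n (x - ξ n)).prod 1 1 =
      (is.map fun n => x - ξ n + η / 2 - (ℓ n : ℂ) / 2 * η).prod • vacuum ℓ
  | [], _ => by simp
  | n :: is, h => by
    rw [List.nodup_cons] at h
    obtain ⟨h0, h1⟩ := vacuum_vecMul_lax_prod x is h.2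
    have hc : EntriesCommute (fun x => lax ℓ η n (x - ξ n))
        fun x => (is.map fun n => lax ℓ η n (x - ξ n)).prod :=
      entriesCommute_list_prod (L := fun n x => lax ℓ η n (x - ξ n)) is
        fun j hj => entriesCommute_lax ℓ η (ne_of_mem_of_not_mem hj h.1).symm _ _
    simp only [List.map_cons, List.prod_cons, Matrix.mul_apply, Fin.sum_univ_two,
      (hc _ _ _ _ _ _).eq, Matrix.vecMul_add, ← Matrix.vecMul_vecMul, h0, h1, Matrix.zero_vecMul,
      Matrix.smul_vecMul, vacuum_vecMul_lax_one_one, vacuum_vecMul_lax_zero_one, smul_zero,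
      zero_add, smul_smul, true_and]
    rw [mul_comm]

/-- Only the `(1, 1)` entry of the Lax product survives, and the twist weights it by `K 0 1`: this
is why `K 0 1 ≠ 0` makes `B` usable. -/
theorem vacuum_vecMul_opB (x : ℂ) :
    vacuum ℓ ᵥ* opB ℓ η ξ K x = (K 0 1 * dFun ℓ η ξ x) • vacuum ℓ := by
  obtain ⟨h0, h1⟩ := vacuum_vecMul_lax_prod ℓ η ξ x (List.finRange N).reverse
    (List.nodup_reverse.mpr (List.nodup_finRange N))
  have h2 : dFun ℓ η ξ x = ((List.finRange N).reverse.map fun n =>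
      x - ξ n + η / 2 - (ℓ n : ℂ) / 2 * η).prod := by
    rw [List.map_reverse, List.prod_reverse, ← List.ofFn_eq_map, List.prod_ofFn, dFun]
    exact Finset.prod_congr rfl fun n _ => by ring
  rw [opB, monodromy_eq, Matrix.mul_apply, Fin.sum_univ_two, h2]
  simp only [Matrix.map_apply, smul_mul_assoc, one_mul, Matrix.vecMul_add, Matrix.vecMul_smul, h0,
    h1, smul_zero, zero_add, smul_smul]

end Monodromy

/-! ### Polynomial dependence on the spectral parameter -/

section PolynomialEntries

open Polynomial

variable {ι : Type*}

/-- The entries of `F x` are polynomials in `x` of degree at most `d`, with matrix of coefficients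
of `x ^ d` equal to `C`. -/
def HasPolynomialEntries (d : ℕ) (C : Matrix ι ι ℂ) (F : ℂ → Matrix ι ι ℂ) : Prop :=
  ∃ P : Matrix ι ι ℂ[X], (∀ x, F x = P.map (eval x)) ∧
    ∀ g h, (P g h).natDegree ≤ d ∧ (P g h).coeff d = C g h

theorem HasPolynomialEntries.add {d : ℕ} {C C' : Matrix ι ι ℂ} {F F' : ℂ → Matrix ι ι ℂ}
    (hF : HasPolynomialEntries d C F) (hF' : HasPolynomialEntries d C' F') :
    HasPolynomialEntries d (C + C') fun x => F x + F' x := by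
  obtain ⟨P, hP, hd⟩ := hF
  obtain ⟨P', hP', hd'⟩ := hF'
  refine ⟨P + P', fun x => ?_, fun g h => ⟨?_, ?_⟩⟩
  · ext g h
    simp [hP, hP']
  · exact natDegree_add_le_of_degree_le (hd g h).1 (hd' g h).1
  · simp [(hd g h).2, (hd' g h).2]

theorem HasPolynomialEntries.mul [Fintype ι] {d d' : ℕ} {C C' : Matrix ι ι ℂ}
    {F F' : ℂ → Matrix ι ι ℂ}
    (hF : HasPolynomialEntries d C F) (hF' : HasPolynomialEntries d' C' F') :
    HasPolynomialEntries (d + d') (C * C') fun x => F x * F' x := by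
  obtain ⟨P, hP, hd⟩ := hF
  obtain ⟨P', hP', hd'⟩ := hF'
  refine ⟨P * P', fun x => ?_, fun g h => ⟨?_, ?_⟩⟩
  · ext g h
    simp [hP, hP', Matrix.mul_apply, eval_finsetSum]
  · rw [Matrix.mul_apply]
    exact natDegree_sum_le_of_forall_le _ _ fun k _ =>
      natDegree_mul_le_of_le (hd g k).1 (hd' k h).1
  · rw [Matrix.mul_apply, finsetSum_coeff, Matrix.mul_apply]
    refine Finset.sum_congr rfl fun k _ => ?_
    rw [coeff_mul_add_eq_of_natDegree_le (hd g k).1 (hd' k h).1, (hd g k).2, (hd' k h).2]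

theorem hasPolynomialEntries_const (C : Matrix ι ι ℂ) : HasPolynomialEntries 0 C fun _ => C :=
  ⟨C.map Polynomial.C, fun x => by ext; simp, fun g h => by simp⟩

theorem hasPolynomialEntries_linear (C C' : Matrix ι ι ℂ) :
    HasPolynomialEntries 1 C fun x => x • C + C' :=
  ⟨C.map (fun z => X * Polynomial.C z) + C'.map Polynomial.C,
    fun x => by ext g h; simp [mul_comm x], fun g h => by
      simp only [Matrix.add_apply, Matrix.map_apply]
      refine ⟨by compute_degree, by compute_degree!⟩⟩

theorem HasPolynomialEntries.continuous {d : ℕ} {C : Matrix ι ι ℂ} {F : ℂ → Matrix ι ι ℂ}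
    (hF : HasPolynomialEntries d C F) : Continuous F := by
  obtain ⟨P, hP, -⟩ := hF
  refine continuous_matrix fun g h => ?_
  simp only [hP, Matrix.map_apply]
  exact (P g h).continuous

variable {N : ℕ} (ℓ : Fin N → ℕ) (η : ℂ) (ξ : Fin N → ℂ) (K : Matrix (Fin 2) (Fin 2) ℂ)

theorem hasPolynomialEntries_lax (n : Fin N) (i j : Fin 2) :
    HasPolynomialEntries 1 ((1 : Matrix (Fin 2) (Fin 2) ℂ) i j • (1 : Op ℓ))
      fun x => lax ℓ η n (x - ξ n) i j := by
  have h : ∀ x, lax ℓ η n (x - ξ n) i j =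
      x • ((1 : Matrix (Fin 2) (Fin 2) ℂ) i j • (1 : Op ℓ)) + lax ℓ η n (0 - ξ n) i j := by
    intro x
    revert i j
    simp only [lax, Fin.forall_fin_two, Matrix.of_apply, Matrix.cons_val', Matrix.cons_val_zero,
      Matrix.cons_val_one, Matrix.cons_val_fin_one, Matrix.one_apply_eq, ne_eq, zero_ne_one,
      one_ne_zero, not_false_eq_true, Matrix.one_apply_ne]
    refine ⟨⟨?_, ?_⟩, ?_, ?_⟩ <;> module
  rw [funext h]
  exact hasPolynomialEntries_linear _ _

theorem hasPolynomialEntries_lax_prod : ∀ (is : List (Fin N)) (i j : Fin 2),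
    HasPolynomialEntries is.length ((1 : Matrix (Fin 2) (Fin 2) ℂ) i j • (1 : Op ℓ))
      fun x => (is.map fun n => lax ℓ η n (x - ξ n)).prod i j
  | [], i, j => by
    have h : (1 : Matrix (Fin 2) (Fin 2) (Op ℓ)) i j =
        (1 : Matrix (Fin 2) (Fin 2) ℂ) i j • (1 : Op ℓ) := by
      simp only [Matrix.one_apply]
      split_ifs <;> simp
    simpa [h] using hasPolynomialEntries_const _
  | n :: is, i, j => by
    simp only [List.map_cons, List.prod_cons, Matrix.mul_apply, Fin.sum_univ_two,
      List.length_cons]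
    have h := ((hasPolynomialEntries_lax ℓ η ξ n i 0).mul
      (hasPolynomialEntries_lax_prod is 0 j)).add ((hasPolynomialEntries_lax ℓ η ξ n i 1).mul
      (hasPolynomialEntries_lax_prod is 1 j))
    rw [add_comm 1] at h
    convert h using 1
    rw [smul_mul_smul_comm, smul_mul_smul_comm, ← add_smul, mul_one,
      ← Fin.sum_univ_two (fun p => (1 : Matrix (Fin 2) (Fin 2) ℂ) i p *
        (1 : Matrix (Fin 2) (Fin 2) ℂ) p j), ← Matrix.mul_apply, mul_one]

theorem hasPolynomialEntries_monodromy (i j : Fin 2) :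
    HasPolynomialEntries N (K i j • (1 : Op ℓ)) fun x => monodromy ℓ η ξ K x i j := by
  have h (p : Fin 2) := (hasPolynomialEntries_const (K i p • (1 : Op ℓ))).mul
    (hasPolynomialEntries_lax_prod ℓ η ξ (List.finRange N).reverse p j)
  have h2 := (h 0).add (h 1)
  rw [List.length_reverse, List.length_finRange, zero_add] at h2
  simp only [monodromy_eq, Matrix.mul_apply, Fin.sum_univ_two, Matrix.map_apply]
  convert h2 using 1
  rw [smul_mul_smul_comm, smul_mul_smul_comm, ← add_smul, mul_one,
      ← Fin.sum_univ_two (fun p => K i p * (1 : Matrix (Fin 2) (Fin 2) ℂ) p j), ← Matrix.mul_apply,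
      mul_one]

end PolynomialEntries

/-! ### Products and induction along lattice paths -/

section Grid

open scoped IsMulCommutative in
/-- A commuting family `f n k` can be multiplied along the lattice paths of a grid. -/
theorem exists_gridProduct {R : Type*} [Monoid R] {N : ℕ} (f : Fin N → ℕ → R)
    (hf : ∀ m i n j, Commute (f m i) (f n j)) :
    ∃ P : (Fin N → ℕ) → R, P 0 = 1 ∧
      ∀ h n, P (Function.update h n (h n + 1)) = P h * f n (h n) := by
  classical
  let s : Set R := Set.range fun p : Fin N × ℕ => f p.1 p.2
  -- The submonoid generated by a commuting family is commutative, so unordered products are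
  -- available inside it.
  have : IsMulCommutative (Submonoid.closure s) := Submonoid.isMulCommutative_closure R (by
    rintro _ ⟨p, rfl⟩ _ ⟨q, rfl⟩
    exact hf _ _ _ _)
  let F : Fin N → ℕ → Submonoid.closure s := fun n k =>
    ⟨f n k, Submonoid.subset_closure ⟨(n, k), rfl⟩⟩
  refine ⟨fun h => ((∏ n, ∏ k ∈ Finset.range (h n), F n k : Submonoid.closure s) : R), ?_, ?_⟩
  · simp only [Pi.zero_apply, Finset.range_zero, Finset.prod_empty, Finset.prod_const_one]
    rfl
  · intro h n
    have key : (∏ m, ∏ k ∈ Finset.range (Function.update h n (h n + 1) m), F m k) =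
        (∏ m, ∏ k ∈ Finset.range (h m), F m k) * F n (h n) := by
      rw [← Finset.prod_erase_mul _ _ (Finset.mem_univ n),
        ← Finset.prod_erase_mul Finset.univ (fun m => ∏ k ∈ Finset.range (h m), F m k)
          (Finset.mem_univ n), Function.update_self, Finset.prod_range_succ, ← mul_assoc]
      congr 2
      refine Finset.prod_congr rfl fun m hm => ?_
      rw [Function.update_of_ne (Finset.ne_of_mem_erase hm)]
    exact congrArg Subtype.val key

/-- Induction on the sum of the coordinates: any nonzero coordinate can be decreased by one. -/
theorem grid_induction {N : ℕ} {p : (Fin N → ℕ) → Prop} (h0 : p 0)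
    (hs : ∀ h n, p h → p (Function.update h n (h n + 1))) (h : Fin N → ℕ) : p h := by
  induction hk : ∑ n, h n generalizing h with
  | zero =>
    have : h = 0 := funext fun n => (Finset.sum_eq_zero_iff.mp hk) n (Finset.mem_univ n)
    rwa [this]
  | succ k ih =>
    obtain ⟨n, -, hn⟩ : ∃ n ∈ Finset.univ, h n ≠ 0 :=
      Finset.exists_ne_zero_of_sum_ne_zero (by omega)
    have e : h = Function.update (Function.update h n (h n - 1)) n
        (Function.update h n (h n - 1) n + 1) := by
      simp [Nat.sub_add_cancel (Nat.pos_of_ne_zero hn)]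
    rw [e]
    apply hs
    apply ih
    have h1 : ∑ m ∈ Finset.univ.erase n, h m + h n = k + 1 := by
      rw [Finset.sum_erase_add _ _ (Finset.mem_univ n), hk]
    have h2 : ∑ m ∈ Finset.univ.erase n, Function.update h n (h n - 1) m =
        ∑ m ∈ Finset.univ.erase n, h m := Finset.sum_congr rfl fun m hm =>
      Function.update_of_ne (Finset.ne_of_mem_erase hm) (h n - 1) h
    rw [← Finset.sum_erase_add _ _ (Finset.mem_univ n), Function.update_self, h2]
    omega

/-- The form of `grid_induction` for a box. -/
theorem state_induction {N : ℕ} {ℓ : Fin N → ℕ} {p : (Fin N → ℕ) → Prop} (h0 : p 0)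
    (hs : ∀ h n, h n < ℓ n → p h → p (Function.update h n (h n + 1))) (h : State ℓ) :
    p fun n => h n := by
  have key : ∀ g : Fin N → ℕ, (∀ n, g n ≤ ℓ n) → p g := by
    refine grid_induction (fun _ => h0) fun g n ih hg => ?_
    have hn : g n < ℓ n := by simpa using hg n
    refine hs g n hn (ih fun m => ?_)
    rcases eq_or_ne m n with rfl | hm
    · exact hn.le
    · simpa [Function.update_of_ne hm] using hg m
  exact key _ fun n => Nat.lt_succ_iff.mp (h n).2

end Grid

/-! ### Genericity and the strings of points -/

section Points

variable {N : ℕ} (ℓ : Fin N → ℕ) {η : ℂ} {ξ : Fin N → ℂ}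

theorem aFun_eq (x : ℂ) : aFun ℓ η ξ x = ∏ n, (x - point ℓ η ξ n (ℓ n)) :=
  Finset.prod_congr rfl fun n _ => by rw [point]; ring

theorem dFun_eq (x : ℂ) : dFun ℓ η ξ x = ∏ n, (x - point ℓ η ξ n 0) :=
  Finset.prod_congr rfl fun n _ => by rw [point]; push_cast; ring

theorem point_succ (n : Fin N) (k : ℕ) : point ℓ η ξ n (k + 1) = point ℓ η ξ n k - η := by
  simp only [point]; push_cast; ring

/-- The parameters are in generic position: different sites have disjoint strings of points. -/
def Generic (η : ℂ) (ξ : Fin N → ℂ) : Prop :=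
  ∀ i j, i ≠ j → ∀ k : ℤ, (ξ i + (ℓ i : ℂ) / 2 * η) - (ξ j + (ℓ j : ℂ) / 2 * η) ≠ (k : ℂ) * η

variable {ℓ}

/-- The shift by `z * η` also covers points just outside a string, such as `ξₙ^{(0)} + η`. -/
theorem Generic.point_sub_ne (hξ : Generic ℓ η ξ) {i j : Fin N} (hij : i ≠ j) (k l : ℕ) (z : ℤ) :
    point ℓ η ξ i k - point ℓ η ξ j l ≠ z * η := by
  intro e
  refine hξ i j hij (z + k - l) ?_
  simp only [point] at e
  push_cast
  linear_combination e

theorem point_injective (hη : η ≠ 0) (n : Fin N) : Function.Injective (point ℓ η ξ n) := by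
  intro k l h
  simp only [point] at h
  have : ((k : ℂ) - l) * η = 0 := by linear_combination -h
  have := (mul_eq_zero.mp this).resolve_right hη
  exact_mod_cast sub_eq_zero.mp this

theorem Generic.point_ne (hξ : Generic ℓ η ξ) (hη : η ≠ 0) {i j : Fin N} {k l : ℕ}
    (h : i = j → k ≠ l) : point ℓ η ξ i k ≠ point ℓ η ξ j l := by
  rcases eq_or_ne i j with rfl | hij
  · exact (point_injective hη i).ne (h rfl)
  · intro e
    exact hξ.point_sub_ne hij k l 0 (by simp [e])

theorem Generic.aFun_point_ne_zero (hξ : Generic ℓ η ξ) (hη : η ≠ 0) {n : Fin N} {k : ℕ}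
    (hk : k < ℓ n) : aFun ℓ η ξ (point ℓ η ξ n k) ≠ 0 := by
  rw [aFun_eq]
  exact Finset.prod_ne_zero_iff.mpr fun m _ =>
    sub_ne_zero.mpr (hξ.point_ne hη fun e => e ▸ hk.ne)

theorem dFun_point_zero (n : Fin N) : dFun ℓ η ξ (point ℓ η ξ n 0) = 0 := by
  rw [dFun_eq]
  exact Finset.prod_eq_zero (Finset.mem_univ n) (sub_self _)

theorem Generic.dFun_point_succ_ne_zero (hξ : Generic ℓ η ξ) (hη : η ≠ 0) (n : Fin N) (k : ℕ) :
    dFun ℓ η ξ (point ℓ η ξ n (k + 1)) ≠ 0 := by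
  rw [dFun_eq]
  exact Finset.prod_ne_zero_iff.mpr fun m _ =>
    sub_ne_zero.mpr (hξ.point_ne hη fun _ => Nat.succ_ne_zero k)

/-- Different labels give different products `∏ₙ (x - ξₙ^{(hₙ)})`. -/
theorem Generic.prod_injective (hξ : Generic ℓ η ξ) (hη : η ≠ 0) {h g : State ℓ}
    (hg : ∀ x, ∏ n, (x - point ℓ η ξ n (h n)) = ∏ n, (x - point ℓ η ξ n (g n))) : h = g := by
  funext n
  have e := hg (point ℓ η ξ n (h n))
  rw [Finset.prod_eq_zero (Finset.mem_univ n) (sub_self _), eq_comm, Finset.prod_eq_zero_iff] at e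
  obtain ⟨m, -, hm⟩ := e
  by_contra hne
  exact hξ.point_ne hη (by rintro rfl e; exact hne (Fin.ext e)) (sub_eq_zero.mp hm)

/-- Some point separates all the products `∏ₙ (x - ξₙ^{(hₙ)})`. -/
theorem Generic.exists_separating (hξ : Generic ℓ η ξ) (hη : η ≠ 0) :
    ∃ x, Function.Injective fun h : State ℓ => ∏ n, (x - point ℓ η ξ n (h n)) := by
  classical
  let q : State ℓ → Polynomial ℂ := fun h =>
    ∏ n, (Polynomial.X - Polynomial.C (point ℓ η ξ n (h n)))
  have hq : ∀ h x, (q h).eval x = ∏ n, (x - point ℓ η ξ n (h n)) := fun h x => by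
    simp [q, Polynomial.eval_prod]
  -- A product of nonzero polynomials is nonzero, so one point avoids the zeros of all pairwise
  -- differences.
  have hne : ∏ p ∈ (Finset.univ : Finset (State ℓ)).offDiag, (q p.1 - q p.2) ≠ 0 := by
    refine Finset.prod_ne_zero_iff.mpr fun p hp => sub_ne_zero.mpr fun e => ?_
    refine (Finset.mem_offDiag.mp hp).2.2 (hξ.prod_injective hη fun x => ?_)
    rw [← hq, ← hq, e]
  obtain ⟨x, hx⟩ : ∃ x, (∏ p ∈ (Finset.univ : Finset (State ℓ)).offDiag,
      (q p.1 - q p.2)).eval x ≠ 0 := by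
    by_contra! hcon
    exact hne (Polynomial.funext fun x => by rw [hcon x, Polynomial.eval_zero])
  refine ⟨x, fun h g e => ?_⟩
  by_contra hhg
  rw [Polynomial.eval_prod, Finset.prod_ne_zero_iff] at hx
  refine hx (h, g) (by simp [hhg]) ?_
  simp only [Polynomial.eval_sub, hq]
  exact sub_eq_zero.mpr e

end Points

/-! ### Shifting the zeros of `B` -/

section Shift

variable {ι : Type*} [Fintype ι] [DecidableEq ι] {η : ℂ}
  {M : ℂ → Matrix (Fin 2) (Fin 2) (Matrix ι ι ℂ)}

/-- The relation gives `(x - y + η) [A(x), A(y)] = 0`. Adding its mirror image under `x ↔ y`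
replaces the factor by `2η`, with no exceptional value of `x - y`. -/
theorem YangBaxter.commute_zero_zero (hM : YangBaxter η M) (hη : η ≠ 0) (x y : ℂ) :
    Commute (M x 0 0) (M y 0 0) := by
  have h1 : (x - y + η) • (M x 0 0 * M y 0 0 - M y 0 0 * M x 0 0) = 0 := by
    linear_combination (norm := module) hM x y 0 0 0 0
  have h2 : (y - x + η) • (M x 0 0 * M y 0 0 - M y 0 0 * M x 0 0) = 0 := by
    linear_combination (norm := module) -hM y x 0 0 0 0
  refine sub_eq_zero.mp ?_
  have h3 : (2 * η) • (M x 0 0 * M y 0 0 - M y 0 0 * M x 0 0) = 0 := by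
    linear_combination (norm := module) h1 + h2
  exact (smul_eq_zero.mp h3).resolve_left (by simp [hη])

/-- `A` at a zero of `B` moves this zero by `-η`. -/
theorem YangBaxter.shift_zero (hM : YangBaxter η M) (hB : Continuous fun x => M x 0 1)
    {u : ι → ℂ} {r : ℂ → ℂ} (hr : Continuous r) {c : ℂ}
    (hu : ∀ x, u ᵥ* M x 0 1 = ((x - c) * r x) • u) (x : ℂ) :
    u ᵥ* M c 0 0 ᵥ* M x 0 1 = ((x - (c - η)) * r x) • u ᵥ* M c 0 0 := by
  have hc : u ᵥ* M c 0 1 = 0 := by rw [hu, sub_self, zero_mul, zero_smul]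
  -- The exchange relation of `B(x)` with `A(c)` carries a factor `x - c`; it is cancelled for `x ≠
  -- c`, and continuity restores the missing point.
  have key : Set.EqOn (fun x => u ᵥ* M c 0 0 ᵥ* M x 0 1)
      (fun x => ((x - (c - η)) * r x) • u ᵥ* M c 0 0) {c}ᶜ := by
    intro x hx
    have hx' : c - x ≠ 0 := sub_ne_zero.mpr (Ne.symm hx)
    have h := congrArg (u ᵥ* ·) (hM x c 0 1 0 0)
    simp only [Matrix.vecMul_smul, Matrix.vecMul_sub, ← Matrix.vecMul_vecMul, hc, hu,
      Matrix.zero_vecMul, Matrix.smul_vecMul, smul_sub, smul_smul] at h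
    refine smul_right_injective _ hx' ?_
    simp only [smul_smul, Matrix.vecMul_vecMul] at h ⊢
    linear_combination (norm := module) h
  exact congrFun (Continuous.ext_on (dense_compl_singleton c)
    (continuous_const.matrix_vecMul hB) (by fun_prop) key) x

/-- At difference `-η` two terms of the exchange relation cancel, which leaves `A(c) B(c-η) = B(c)
A(c-η)`. -/
theorem YangBaxter.raise_eq_zero (hM : YangBaxter η M) (hη : η ≠ 0) {u : ι → ℂ} {c : ℂ}
    (hu : u ᵥ* M c 0 1 = 0) : u ᵥ* M c 0 0 ᵥ* M (c - η) 0 1 = 0 := by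
  have h := congrArg (u ᵥ* ·) (hM (c - η) c 0 1 0 0)
  simp only [Matrix.vecMul_smul, Matrix.vecMul_sub, ← Matrix.vecMul_vecMul, hu,
    Matrix.zero_vecMul] at h
  refine smul_right_injective _ hη ?_
  simp only
  linear_combination (norm := module) h

/-- The same cancellation gives `D(c) B(c+η) = B(c) D(c+η)`. -/
theorem YangBaxter.lower_eq_zero (hM : YangBaxter η M) (hη : η ≠ 0) {u : ι → ℂ} {c : ℂ}
    (hu : u ᵥ* M c 0 1 = 0) : u ᵥ* M c 1 1 ᵥ* M (c + η) 0 1 = 0 := by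
  have h := congrArg (u ᵥ* ·) (hM c (c + η) 1 1 0 1)
  simp only [Matrix.vecMul_smul, Matrix.vecMul_sub, ← Matrix.vecMul_vecMul, hu,
    Matrix.zero_vecMul] at h
  refine smul_right_injective _ hη ?_
  simp only
  linear_combination (norm := module) -h

/-- On the kernel of `B(c)` the quantum determinant loses its `B C` term, so `D` at the shifted zero
undoes `A` up to a scalar. -/
theorem HasQuantumDet.raise_lower {Δ : ℂ → ℂ} (hM : HasQuantumDet η Δ M) {u : ι → ℂ} {c : ℂ}
    (hu : u ᵥ* M c 0 1 = 0) : u ᵥ* M c 0 0 ᵥ* M (c - η) 1 1 = Δ c • u := by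
  have h := congrArg (u ᵥ* ·) (hM c 0 1)
  simpa [Matrix.vecMul_smul, Matrix.vecMul_sub, ← Matrix.vecMul_vecMul, hu] using h

end Shift

/-- A matrix with an eigenbasis of covectors and nonzero eigenvalues is injective on covectors. -/
theorem eq_zero_of_vecMul_eq_zero {ι : Type*} [Fintype ι] (b : Module.Basis ι ℂ (ι → ℂ))
    {M : Matrix ι ι ℂ} {μ : ι → ℂ}
    (hb : ∀ i, b i ᵥ* M = μ i • b i) (hμ : ∀ i, μ i ≠ 0) {w : ι → ℂ} (hw : w ᵥ* M = 0) :
    w = 0 := by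
  have h : ∑ i, (b.repr w i * μ i) • b i = 0 := by
    rw [← hw]
    conv_rhs => rw [← b.sum_repr w]
    rw [Matrix.sum_vecMul]
    exact Finset.sum_congr rfl fun i _ => by rw [Matrix.smul_vecMul, hb, smul_smul]
  have h0 := Fintype.linearIndependent_iff.mp b.linearIndependent _ h
  refine b.ext_elem fun i => ?_
  simpa using (mul_eq_zero.mp (h0 i)).resolve_right (hμ i)

/-! ### Second order difference equations and factorization -/

section Recursion

variable {m : ℕ}

/-- `f` solves the second order difference equation `τ f(k) = α f(k + 1) + β f(k - 1)`. -/
def IsRecursionSolution (τ α β f : Fin (m + 1) → ℂ) : Prop :=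
  ∀ k, τ k * f k = α k * up f k + β k * down f k

/-- Solutions are determined by their value at `0`. -/
theorem exists_recursionSolution_factor {τ α β : Fin (m + 1) → ℂ}
    (hα : ∀ k : Fin (m + 1), (k : ℕ) < m → α k ≠ 0) :
    ∃ q : Fin (m + 1) → ℂ, ∀ f, IsRecursionSolution τ α β f → ∀ k, f k = f 0 * q k := by
  have key : ∀ (k : ℕ) (hk : k < m + 1), ∃ c : ℂ, ∀ f, IsRecursionSolution τ α β f →
      f ⟨k, hk⟩ = f 0 * c := by
    intro k
    induction k using Nat.strong_induction_on with
    | _ k ih =>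
      intro hk
      rcases k with _ | k
      · exact ⟨1, fun f _ => by rw [mul_one]; rfl⟩
      · have hα' := hα ⟨k, by omega⟩ (by simp only; omega)
        obtain ⟨c, hc⟩ := ih k (by omega) (by omega)
        -- At label `0` the lower neighbour is zero by convention, so one initial value determines a
        -- solution of a second order equation.
        obtain ⟨c', hc'⟩ : ∃ c' : ℂ, ∀ f, IsRecursionSolution τ α β f →
            down f ⟨k, by omega⟩ = f 0 * c' := by
          rcases k with _ | j
          · exact ⟨0, fun f _ => by simp [down]⟩
          · obtain ⟨c', hc'⟩ := ih j (by omega) (by omega)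
            exact ⟨c', fun f hf => by simpa [down] using hc' f hf⟩
        refine ⟨(τ ⟨k, by omega⟩ * c - β ⟨k, by omega⟩ * c') / α ⟨k, by omega⟩, fun f hf => ?_⟩
        have h := hf ⟨k, by omega⟩
        rw [hc f hf, hc' f hf, up, dif_pos hk] at h
        field_simp
        linear_combination -h
  choose c hc using key
  exact ⟨fun k => c k k.2, fun f hf k => hc k k.2 f hf⟩

theorem IsRecursionSolution.of_smul {τ α β f : Fin (m + 1) → ℂ} {c : ℂ} (hc : c ≠ 0)
    (hf : IsRecursionSolution τ α β fun k => c * f k) : IsRecursionSolution τ α β f := by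
  intro k
  have h := hf k
  refine mul_left_cancel₀ hc ?_
  simp only [up, down] at h ⊢
  split_ifs at h ⊢ <;> linear_combination h

theorem IsRecursionSolution.smul {τ α β f : Fin (m + 1) → ℂ}
    (hf : IsRecursionSolution τ α β f) (c : ℂ) : IsRecursionSolution τ α β fun k => c * f k := by
  intro k
  have h := hf k
  simp only [up, down] at h ⊢
  split_ifs at h ⊢ <;> linear_combination c * h

/-- The coordinates are reset to `0` one at a time, each reset splitting off its factor `q n (h n)`.
-/
theorem eq_mul_prod_of_factor {N : ℕ} {ℓ : Fin N → ℕ} {F : State ℓ → ℂ}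
    {q : ∀ n, Fin (ℓ n + 1) → ℂ}
    (hF : ∀ h n, F h = F (Function.update h n 0) * q n (h n)) (h : State ℓ) :
    F h = F 0 * ∏ n, q n (h n) := by
  have key : ∀ s : Finset (Fin N), F h = F (fun n => if n ∈ s then 0 else h n) *
      ∏ n ∈ s, q n (h n) := by
    intro s
    induction s using Finset.induction_on with
    | empty => simp
    | insert a s ha ih =>
      rw [ih, hF _ a, Finset.prod_insert ha]
      have e : Function.update (fun n => if n ∈ s then 0 else h n) a 0 =
          fun n => if n ∈ insert a s then 0 else h n := by
        funext n
        rcases eq_or_ne n a with rfl | hn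
        · simp
        · simp [hn]
      simp only [e, ha, if_false]
      ring
  have h1 := key Finset.univ
  simp only [Finset.mem_univ, if_true] at h1
  exact h1

end Recursion

/-! ### Separation of the spectral problem -/

section Separation

variable {N : ℕ} {ℓ : Fin N → ℕ} {η : ℂ} {ξ : Fin N → ℂ}

theorem ext_dotProduct {ι : Type*} [Fintype ι] {a b : ι → ℂ} (h : ∀ w, w ⬝ᵥ a = w ⬝ᵥ b) :
    a = b :=
  dotProduct_eq _ _ fun w => by rw [dotProduct_comm a, dotProduct_comm b, h]

theorem up_dotProduct {ι : Type} [Fintype ι] {m : ℕ} (f : Fin (m + 1) → ι → ℂ) (k : Fin (m + 1))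
    (ψ : ι → ℂ) : up f k ⬝ᵥ ψ = up (fun j => f j ⬝ᵥ ψ) k := by
  simp only [up]
  split_ifs <;> simp

theorem down_dotProduct {ι : Type} [Fintype ι] {m : ℕ} (f : Fin (m + 1) → ι → ℂ)
    (k : Fin (m + 1)) (ψ : ι → ℂ) : down f k ⬝ᵥ ψ = down (fun j => f j ⬝ᵥ ψ) k := by
  simp only [down]
  split_ifs <;> simp

/-- A coordinate `g` with `ψ g ≠ 0` gives `t(x) = ∑ₖ T(x)_{gk} ψₖ / ψ_g`. -/
theorem eigenvalue_polynomial {ι : Type*} [Fintype ι] [DecidableEq ι] {d : ℕ} {c : ℂ}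
    {T : ℂ → Matrix ι ι ℂ} (hT : HasPolynomialEntries d (c • 1) T) {t : ℂ → ℂ} {ψ : ι → ℂ}
    (hψ : ψ ≠ 0) (h : ∀ x, T x *ᵥ ψ = t x • ψ) :
    ∃ p : Polynomial ℂ, p.natDegree ≤ d ∧ p.coeff d = c ∧ ∀ x, t x = p.eval x := by
  obtain ⟨P, hP, hd⟩ := hT
  obtain ⟨g, hg⟩ := Function.ne_iff.mp hψ
  simp only [Pi.zero_apply] at hg
  refine ⟨∑ k, P g k * Polynomial.C (ψ k / ψ g), ?_, ?_, fun x => ?_⟩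
  · refine Polynomial.natDegree_sum_le_of_forall_le _ _ fun k _ => ?_
    exact (Polynomial.natDegree_mul_C_le _ _).trans (hd g k).1
  · simp [Polynomial.finsetSum_coeff, (hd _ _).2, Matrix.one_apply, hg]
  · have h1 := congrFun (h x) g
    simp only [hP, Matrix.mulVec, dotProduct, Matrix.map_apply, Pi.smul_apply, smul_eq_mul] at h1
    rw [Polynomial.eval_finsetSum, eq_comm, ← mul_left_inj' hg, ← h1, Finset.sum_mul]
    refine Finset.sum_congr rfl fun k _ => ?_
    rw [Polynomial.eval_mul, Polynomial.eval_C, mul_assoc, div_mul_cancel₀ _ hg]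

/-- A vector is an eigenvector as soon as the eigenvalue equation holds at `d` suitable points, on
each covector of a basis. -/
theorem mulVec_eq_of_points {ι : Type*} [Fintype ι] [DecidableEq ι] {d : ℕ} {c : ℂ}
    {T : ℂ → Matrix ι ι ℂ} (hT : HasPolynomialEntries d (c • 1) T) {p : Polynomial ℂ}
    (hp : p.natDegree ≤ d) (hpc : p.coeff d = c) {ψ : ι → ℂ} (v : Module.Basis ι ℂ (ι → ℂ))
    (z : ι → Fin d → ℂ) (hz : ∀ i, Function.Injective (z i))
    (h : ∀ i n, v i ᵥ* T (z i n) ⬝ᵥ ψ = p.eval (z i n) * (v i ⬝ᵥ ψ)) (x : ℂ) :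
    T x *ᵥ ψ = p.eval x • ψ := by
  obtain ⟨P, hP, hd⟩ := hT
  have key : ∀ i, v i ⬝ᵥ (T x *ᵥ ψ) = v i ⬝ᵥ (p.eval x • ψ) := by
    intro i
    -- `Q` is the defect of the eigenvalue equation tested on `v i`. Its coefficients of `X ^ d`
    -- cancel, so `d` distinct zeros suffice.
    let Q : Polynomial ℂ := ∑ g, Polynomial.C (v i g) * (∑ k, P g k * Polynomial.C (ψ k)) -
      p * Polynomial.C (v i ⬝ᵥ ψ)
    have hQ : ∀ y, Q.eval y = v i ⬝ᵥ (T y *ᵥ ψ) - p.eval y * (v i ⬝ᵥ ψ) := by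
      intro y
      simp [Q, Polynomial.eval_finsetSum, hP, Matrix.mulVec, dotProduct]
    have hQd : Q.natDegree ≤ d := by
      refine (Polynomial.natDegree_sub_le _ _).trans (max_le ?_ ?_)
      · refine Polynomial.natDegree_sum_le_of_forall_le _ _ fun g _ => ?_
        refine (Polynomial.natDegree_C_mul_le _ _).trans ?_
        refine Polynomial.natDegree_sum_le_of_forall_le _ _ fun k _ => ?_
        exact (Polynomial.natDegree_mul_C_le _ _).trans (hd g k).1
      · exact (Polynomial.natDegree_mul_C_le _ _).trans hp
    have hQc : Q.coeff d = 0 := by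
      simp only [Q, Polynomial.coeff_sub, Polynomial.finsetSum_coeff, Polynomial.coeff_C_mul,
        Polynomial.coeff_mul_C, (hd _ _).2, hpc, Matrix.smul_apply, Matrix.one_apply, smul_eq_mul,
        mul_ite, mul_one, mul_zero, ite_mul, zero_mul, Finset.sum_ite_eq, Finset.mem_univ, if_true,
        dotProduct, Finset.mul_sum]
      rw [sub_eq_zero]
      exact Finset.sum_congr rfl fun g _ => by ring
    have hQ0 : Q = 0 := by
      refine Polynomial.eq_zero_of_degree_lt_of_eval_finset_eq_zero
        (Finset.univ.image (z i)) ?_ ?_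
      · rw [Finset.card_image_of_injective _ (hz i), Finset.card_univ, Fintype.card_fin,
          Polynomial.degree_lt_iff_coeff_zero]
        intro k hk
        rcases hk.eq_or_lt with rfl | hk
        · exact hQc
        · exact Polynomial.coeff_eq_zero_of_natDegree_lt (hQd.trans_lt hk)
      · intro y hy
        obtain ⟨n, -, rfl⟩ := Finset.mem_image.mp hy
        rw [hQ, Matrix.dotProduct_mulVec, h, sub_self]
    have h0 := hQ x
    rw [hQ0, Polynomial.eval_zero] at h0
    rw [dotProduct_smul, smul_eq_mul]
    exact (sub_eq_zero.mp h0.symm)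
  have key2 : ∀ w : ι → ℂ, w ⬝ᵥ (T x *ᵥ ψ) = w ⬝ᵥ (p.eval x • ψ) := by
    intro w
    rw [← v.sum_repr w, sum_dotProduct, sum_dotProduct]
    exact Finset.sum_congr rfl fun i _ => by rw [smul_dotProduct, smul_dotProduct, key]
  exact ext_dotProduct key2

/-- Separation of variables, given the action of the transfer matrix on the covector basis. -/
theorem separation_of_action (hξ : Generic ℓ η ξ) (hη : η ≠ 0) {T : ℂ → Op ℓ} {c κ₁ κ₂ : ℂ}
    (hκ : κ₁ ≠ 0) (hT : HasPolynomialEntries N (c • 1) T)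
    (v : Module.Basis (State ℓ) ℂ (State ℓ → ℂ))
    (hv : ∀ h n, v h ᵥ* T (point ℓ η ξ n (h n)) =
      (κ₁ * aFun ℓ η ξ (point ℓ η ξ n (h n))) • up (fun k => v (Function.update h n k)) (h n) +
      (κ₂ * dFun ℓ η ξ (point ℓ η ξ n (h n))) • down (fun k => v (Function.update h n k)) (h n))
    (t : ℂ → ℂ) (ψ : State ℓ → ℂ) (hψ : ψ ≠ 0) :
    (∀ x, T x *ᵥ ψ = t x • ψ) ↔
      (∃ p : Polynomial ℂ, p.natDegree ≤ N ∧ p.coeff N = c ∧ ∀ x, t x = p.eval x) ∧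
      ∃ (c : ℂ) (Q : ∀ n : Fin N, Fin (ℓ n + 1) → ℂ),
        (∀ h, v h ⬝ᵥ ψ = c * ∏ n, Q n (h n)) ∧
        ∀ (n : Fin N) (k : Fin (ℓ n + 1)), t (point ℓ η ξ n k) * Q n k =
          κ₁ * aFun ℓ η ξ (point ℓ η ξ n k) * up (Q n) k +
          κ₂ * dFun ℓ η ξ (point ℓ η ξ n k) * down (Q n) k := by
  have hv' : ∀ h n, v h ᵥ* T (point ℓ η ξ n (h n)) ⬝ᵥ ψ =
      κ₁ * aFun ℓ η ξ (point ℓ η ξ n (h n)) * up (fun k => v (Function.update h n k) ⬝ᵥ ψ) (h n) +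
      κ₂ * dFun ℓ η ξ (point ℓ η ξ n (h n)) *
        down (fun k => v (Function.update h n k) ⬝ᵥ ψ) (h n) := by
    intro h n
    rw [hv, add_dotProduct, smul_dotProduct, smul_dotProduct, up_dotProduct, down_dotProduct,
      smul_eq_mul, smul_eq_mul]
  let τ : ∀ n, Fin (ℓ n + 1) → ℂ := fun n k => t (point ℓ η ξ n k)
  let α : ∀ n, Fin (ℓ n + 1) → ℂ := fun n k => κ₁ * aFun ℓ η ξ (point ℓ η ξ n k)
  let β : ∀ n, Fin (ℓ n + 1) → ℂ := fun n k => κ₂ * dFun ℓ η ξ (point ℓ η ξ n k)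
  constructor
  · intro h
    refine ⟨eigenvalue_polynomial hT hψ h, ?_⟩
    have hsol : ∀ (g : State ℓ) n, IsRecursionSolution (τ n) (α n) (β n)
        fun k => v (Function.update g n k) ⬝ᵥ ψ := by
      intro g n k
      have h1 := hv' (Function.update g n k) n
      simp only [Function.update_self, Function.update_idem] at h1
      rw [← h1, ← Matrix.dotProduct_mulVec, h, dotProduct_smul, smul_eq_mul]
    have hq : ∀ n, ∃ q : Fin (ℓ n + 1) → ℂ, ∀ f, IsRecursionSolution (τ n) (α n) (β n) f →
        ∀ k, f k = f 0 * q k := fun n => exists_recursionSolution_factor fun k hk =>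
      mul_ne_zero hκ (hξ.aFun_point_ne_zero hη hk)
    choose q hq using hq
    have hF : ∀ g : State ℓ, v g ⬝ᵥ ψ = v 0 ⬝ᵥ ψ * ∏ n, q n (g n) :=
      eq_mul_prod_of_factor (F := fun g => v g ⬝ᵥ ψ) fun g n => by
        simpa using hq n _ (hsol g n) (g n)
    -- Otherwise the factorized wave function would vanish on the whole basis.
    have h0 : v 0 ⬝ᵥ ψ ≠ 0 := by
      intro h0
      refine hψ (ext_dotProduct fun w => ?_)
      rw [← v.sum_repr w, sum_dotProduct, sum_dotProduct]
      exact Finset.sum_congr rfl fun i _ => by simp [smul_dotProduct, hF i, h0]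
    refine ⟨v 0 ⬝ᵥ ψ, q, hF, fun n => ?_⟩
    refine IsRecursionSolution.of_smul (τ := τ n) (α := α n) (β := β n) h0 ?_
    -- With all other labels at `0`, the wave function in the label `n` is a nonzero multiple of `q
    -- n`, which therefore solves the recursion itself.
    have e : (fun k => v 0 ⬝ᵥ ψ * q n k) = fun k => v (Function.update 0 n k) ⬝ᵥ ψ := by
      funext k
      have h2 := hq n _ (hsol 0 n) k
      rw [h2]
      congr 3
      exact (Function.update_eq_self n (0 : State ℓ)).symm
    rw [e]
    exact hsol 0 n
  · rintro ⟨⟨p, hp, hpc, hpt⟩, C, Q, hC, hQ⟩ x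
    rw [hpt]
    refine mulVec_eq_of_points hT hp hpc v (fun h n => point ℓ η ξ n (h n)) (fun h m n e => ?_)
      (fun h n => ?_) x
    · by_contra hmn
      exact hξ.point_ne hη (fun e => absurd e hmn) e
    · rw [hv', ← hpt]
      -- With the other labels frozen, the product wave function is a multiple of `Q n`, and the
      -- recursion is linear.
      have e : (fun k => v (Function.update h n k) ⬝ᵥ ψ) =
          fun k => (C * ∏ m ∈ Finset.univ.erase n, Q m (h m)) * Q n k := by
        funext k
        rw [hC, ← Finset.mul_prod_erase _ _ (Finset.mem_univ n), Function.update_self,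
          Finset.prod_congr rfl fun m hm => by
            rw [Function.update_of_ne (Finset.ne_of_mem_erase hm)]]
        ring
      have h1 := IsRecursionSolution.smul (τ := τ n) (α := α n) (β := β n) (hQ n)
        (C * ∏ m ∈ Finset.univ.erase n, Q m (h m)) (h n)
      have e' := congrFun e (h n)
      simp only [Function.update_eq_self] at e'
      rw [e, ← h1, e']

end Separation

/-! ### The eigenbasis of covectors of `B` -/

section CovectorBasis

variable {N : ℕ} {ℓ : Fin N → ℕ} {η : ℂ} {ξ : Fin N → ℂ} {K : Matrix (Fin 2) (Fin 2) ℂ}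

/-- `A` and `B` do not see the second row of the twist, which may therefore be altered to change its
determinant. -/
theorem monodromy_zero_eq {K' : Matrix (Fin 2) (Fin 2) ℂ} (h : K 0 = K' 0) (x : ℂ) (j : Fin 2) :
    monodromy ℓ η ξ K x 0 j = monodromy ℓ η ξ K' x 0 j := by
  simp only [monodromy_eq, Matrix.mul_apply, Matrix.map_apply, h]

/-- If `K₁₂ ≠ 0`, then `A` does not annihilate an eigencovector of `B` at an interior zero. -/
theorem raise_ne_zero (hb : K 0 1 ≠ 0) {u : State ℓ → ℂ} (hu : u ≠ 0) {c : ℂ}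
    (hB : u ᵥ* opB ℓ η ξ K c = 0) (ha : aFun ℓ η ξ c ≠ 0) (hd : dFun ℓ η ξ (c - η) ≠ 0) :
    u ᵥ* opA ℓ η ξ K c ≠ 0 := by
  intro h0
  -- The new second row makes the determinant equal to `K 0 1`, hence nonzero even when `K` is
  -- singular.
  let K' : Matrix (Fin 2) (Fin 2) ℂ := !![K 0 0, K 0 1; -1, 0]
  have hK : K 0 = K' 0 := by
    funext j
    revert j
    simp [K', Fin.forall_fin_two]
  have hdet : K'.det = K 0 1 := by simp [K', Matrix.det_fin_two]
  have h := (hasQuantumDet_monodromy ℓ η ξ K').raise_lower (u := u) (c := c)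
    (by rw [← monodromy_zero_eq hK]; exact hB)
  rw [← monodromy_zero_eq hK, show u ᵥ* monodromy ℓ η ξ K c 0 0 = 0 from h0,
    Matrix.zero_vecMul, hdet, eq_comm, smul_eq_zero] at h
  exact h.elim (mul_ne_zero hb (mul_ne_zero ha hd)) hu

/-- The covector basis, constructed from the vacuum by repeated action of `A`. -/
theorem exists_covectorBasis (hη : η ≠ 0) (hξ : Generic ℓ η ξ) (hb : K 0 1 ≠ 0) {κ : ℂ}
    (hκ : κ ≠ 0) :
    ∃ v : Module.Basis (State ℓ) ℂ (State ℓ → ℂ),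
      (∀ h x, v h ᵥ* opB ℓ η ξ K x = (K 0 1 * ∏ n, (x - point ℓ η ξ n (h n))) • v h) ∧
      ∀ h n, v h ᵥ* opA ℓ η ξ K (point ℓ η ξ n (h n)) =
        (κ * aFun ℓ η ξ (point ℓ η ξ n (h n))) • up (fun k => v (Function.update h n k)) (h n) := by
  have hYB := yangBaxter_monodromy ℓ η ξ K
  have hBc : Continuous fun x => monodromy ℓ η ξ K x 0 1 :=
    (hasPolynomialEntries_monodromy ℓ η ξ K 0 1).continuous
  -- Dividing by `κ a` fixes the normalization of the shift. At the top label `a` vanishes and the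
  -- inverse is `0` by convention, so the covectors beyond the box are zero; the eigenvalue identity
  -- still holds for them.
  obtain ⟨P, hP0, hPs⟩ := exists_gridProduct
    (fun n k => (κ * aFun ℓ η ξ (point ℓ η ξ n k))⁻¹ • opA ℓ η ξ K (point ℓ η ξ n k))
    fun m i n j => ((hYB.commute_zero_zero hη _ _).smul_left _).smul_right _
  let w : (Fin N → ℕ) → State ℓ → ℂ := fun h => vacuum ℓ ᵥ* P h
  have hw0 : w 0 = vacuum ℓ := by simp only [w, hP0, Matrix.vecMul_one]
  have hws : ∀ h n, w (Function.update h n (h n + 1)) =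
      (κ * aFun ℓ η ξ (point ℓ η ξ n (h n)))⁻¹ • w h ᵥ* opA ℓ η ξ K (point ℓ η ξ n (h n)) := by
    intro h n
    simp only [w, hPs, ← Matrix.vecMul_vecMul, Matrix.vecMul_smul]
  have hwB : ∀ h x, w h ᵥ* opB ℓ η ξ K x = (K 0 1 * ∏ n, (x - point ℓ η ξ n (h n))) • w h := by
    intro h
    induction h using grid_induction with
    | h0 =>
      intro x
      rw [hw0, vacuum_vecMul_opB, dFun_eq]
      rfl
    | hs h n ih =>
      intro x
      have h1 := hYB.shift_zero hBc (u := w h) (c := point ℓ η ξ n (h n))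
        (r := fun x => K 0 1 * ∏ m ∈ Finset.univ.erase n, (x - point ℓ η ξ m (h m)))
        (by fun_prop) (fun x => by
          rw [← opB, ih, ← Finset.mul_prod_erase _ _ (Finset.mem_univ n)]
          congr 1; ring) x
      have h2 : ∏ m ∈ Finset.univ.erase n,
          (x - point ℓ η ξ m (Function.update h n (h n + 1) m)) =
          ∏ m ∈ Finset.univ.erase n, (x - point ℓ η ξ m (h m)) :=
        Finset.prod_congr rfl fun m hm => by
          rw [Function.update_of_ne (Finset.ne_of_mem_erase hm)]
      rw [hws, Matrix.smul_vecMul, opB, opA, h1, smul_comm,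
        ← Finset.mul_prod_erase _ _ (Finset.mem_univ n), Function.update_self, point_succ, h2]
      congr 1; ring
  have hne : ∀ h : State ℓ, w (fun n => h n) ≠ 0 := by
    refine state_induction (p := fun h => w h ≠ 0) ?_ fun h n hn ih => ?_
    · rw [hw0, vacuum]
      intro e
      have e0 := congrFun e 0
      simp at e0
    · have ha := hξ.aFun_point_ne_zero hη hn
      rw [hws]
      refine smul_ne_zero (inv_ne_zero (mul_ne_zero hκ ha)) (raise_ne_zero hb ih ?_ ha ?_)
      · rw [hwB, Finset.prod_eq_zero (Finset.mem_univ n) (sub_self _), mul_zero, zero_smul]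
      · rw [← point_succ]
        exact hξ.dFun_point_succ_ne_zero hη n _
  -- At `x₀` the covectors are eigenvectors of one operator with distinct eigenvalues.
  obtain ⟨x₀, hx₀⟩ := hξ.exists_separating hη
  have hli : LinearIndependent ℂ fun h : State ℓ => w fun n => h n := by
    refine Module.End.eigenvectors_linearIndependent' (Matrix.vecMulLinear (opB ℓ η ξ K x₀))
      (fun h : State ℓ => K 0 1 * ∏ n, (x₀ - point ℓ η ξ n (h n)))
      (fun h g e => hx₀ (mul_left_cancel₀ hb e)) _ fun h => ?_
    exact ⟨Module.End.mem_eigenspace_iff.mpr (hwB _ _), hne h⟩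
  let v := basisOfLinearIndependentOfCardEqFinrank hli (by simp)
  have hv : ∀ h, v h = w fun n => h n := fun h => by simp [v]
  have hvB : ∀ h x, v h ᵥ* opB ℓ η ξ K x =
      (K 0 1 * ∏ n, (x - point ℓ η ξ n (h n))) • v h := fun h x => by rw [hv, hwB]
  refine ⟨v, hvB, fun h n => ?_⟩
  by_cases hn : (h n : ℕ) + 1 < ℓ n + 1
  · have ha := hξ.aFun_point_ne_zero (ξ := ξ) hη (Nat.lt_of_succ_lt_succ hn)
    have e : (fun m => ((Function.update h n ⟨(h n : ℕ) + 1, hn⟩ m : Fin (ℓ m + 1)) : ℕ)) =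
        Function.update (fun m => (h m : ℕ)) n ((h n : ℕ) + 1) := by
      funext m
      rcases eq_or_ne m n with rfl | hm
      · simp
      · simp [Function.update_of_ne hm]
    rw [up, dif_pos hn, hv, hv, e, hws (fun m => (h m : ℕ)) n, smul_smul,
      mul_inv_cancel₀ (mul_ne_zero hκ ha), one_smul]
  -- At the top label the raised covector is annihilated by `B` at `ξₙ^{(ℓ n + 1)}`, where no basis
  -- eigenvalue of `B` vanishes; hence it is zero.
  · have hn' : (h n : ℕ) = ℓ n := by omega
    rw [up, dif_neg hn, smul_zero]
    refine eq_zero_of_vecMul_eq_zero v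
      (fun g => hvB g (point ℓ η ξ n (h n) - η)) (fun g => ?_) (hYB.raise_eq_zero hη ?_)
    · refine mul_ne_zero hb (Finset.prod_ne_zero_iff.mpr fun m _ => sub_ne_zero.mpr ?_)
      rw [← point_succ]
      exact hξ.point_ne hη fun e => by subst e; omega
    · rw [← opB, hvB, Finset.prod_eq_zero (Finset.mem_univ n) (sub_self _), mul_zero, zero_smul]

/-- Above label `0`, `⟨h|` is a multiple of a raised covector, and the quantum determinant says how
`D` undoes the raising. At label `0`, `d` vanishes, and the result of `D` is annihilated by `B` at
`ξₙ^{(0)} + η`, where no basis eigenvalue vanishes. -/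
theorem lowering_of_raising (hη : η ≠ 0) (hξ : Generic ℓ η ξ) (hb : K 0 1 ≠ 0) {κ₁ κ₂ : ℂ}
    (hκ : κ₁ ≠ 0) (hdet : κ₁ * κ₂ = K.det) (v : Module.Basis (State ℓ) ℂ (State ℓ → ℂ))
    (hvB : ∀ h x, v h ᵥ* opB ℓ η ξ K x = (K 0 1 * ∏ n, (x - point ℓ η ξ n (h n))) • v h)
    (hvA : ∀ h n, v h ᵥ* opA ℓ η ξ K (point ℓ η ξ n (h n)) =
        (κ₁ * aFun ℓ η ξ (point ℓ η ξ n (h n))) • up (fun k => v (Function.update h n k)) (h n))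
    (h : State ℓ) (n : Fin N) : v h ᵥ* opD ℓ η ξ K (point ℓ η ξ n (h n)) =
        (κ₂ * dFun ℓ η ξ (point ℓ η ξ n (h n))) •
          down (fun k => v (Function.update h n k)) (h n) := by
  have hker : ∀ g : State ℓ, v g ᵥ* opB ℓ η ξ K (point ℓ η ξ n (g n)) = 0 := fun g => by
    rw [hvB, Finset.prod_eq_zero (Finset.mem_univ n) (sub_self _), mul_zero, zero_smul]
  by_cases hn : (h n : ℕ) = 0
  · rw [hn, dFun_point_zero, mul_zero, zero_smul, ← hn]
    refine eq_zero_of_vecMul_eq_zero v (fun g => hvB g (point ℓ η ξ n (h n) + η)) (fun g => ?_)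
      ((yangBaxter_monodromy ℓ η ξ K).lower_eq_zero hη (hker h))
    refine mul_ne_zero hb (Finset.prod_ne_zero_iff.mpr fun m _ => ?_)
    rcases eq_or_ne n m with rfl | hm
    · intro e
      have e2 : ((g n : ℕ) + 1 : ℂ) * η = 0 := by
        rw [hn] at e
        simp only [point] at e
        push_cast at e
        linear_combination e
      exact (mul_ne_zero (Nat.cast_add_one_ne_zero _) hη) e2
    · intro e
      refine hξ.point_sub_ne hm (h n) (g m) (-1) ?_
      push_cast
      linear_combination e
  · obtain ⟨k, hk⟩ := Nat.exists_eq_succ_of_ne_zero hn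
    have hkl : k < ℓ n := by omega
    -- `g` lies one step below `h` at site `n`, so `A` raises `v g` to a nonzero multiple of `v h`.
    let g : State ℓ := Function.update h n ⟨k, by omega⟩
    have hgn : ((g n : Fin (ℓ n + 1)) : ℕ) = k := by simp [g]
    have hgk : (fun j => v (Function.update g n j)) = fun j => v (Function.update h n j) := by
      funext j
      simp [g]
    have ha := hξ.aFun_point_ne_zero (ξ := ξ) hη hkl
    have hup : up (fun j => v (Function.update h n j)) (g n) = v h := by
      rw [up, dif_pos (by omega)]
      congr 1
      rw [Function.update_eq_self_iff]
      exact Fin.ext (by simp only [hgn]; omega)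
    have hA := hvA g n
    rw [hgk, hup] at hA
    have hq := (hasQuantumDet_monodromy ℓ η ξ K).raise_lower (hker g)
    rw [← opA, ← opD, hA, hgn, ← point_succ, Matrix.smul_vecMul, ← hdet] at hq
    have hdown : down (fun j => v (Function.update h n j)) (h n) = v g := by
      rw [down, if_neg hn]
      congr 2
      exact Fin.ext (by simp only; omega)
    rw [hdown, hk]
    refine smul_right_injective _ (mul_ne_zero hκ ha) ?_
    simp only [Nat.succ_eq_add_one, hq, smul_smul]
    congr 1
    ring

/-- The operators which are diagonal in a covector basis. -/
theorem exists_separateVariables {ι : Type*} [Fintype ι] [DecidableEq ι]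
    (v : Module.Basis ι ℂ (ι → ℂ)) :
    ∃ Δ : (ι → ℂ) → Matrix ι ι ℂ, ∀ μ i, v i ᵥ* Δ μ = μ i • v i := by
  refine ⟨fun μ => (LinearMap.toMatrix' (v.constr ℂ fun i => μ i • v i))ᵀ, fun μ i => ?_⟩
  rw [Matrix.vecMul_transpose, LinearMap.toMatrix'_mulVec, Module.Basis.constr_basis]

theorem matrix_ext_of_basis {ι : Type*} [Fintype ι] (v : Module.Basis ι ℂ (ι → ℂ))
    {A B : Matrix ι ι ℂ} (h : ∀ i, v i ᵥ* A = v i ᵥ* B) : A = B := by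
  classical
  have h1 : Matrix.vecMulLinear A = Matrix.vecMulLinear B := v.ext h
  ext i j
  simpa using congrFun (LinearMap.congr_fun h1 (Pi.single i 1)) j

theorem vecMul_list_prod {ι κ : Type*} [Fintype ι] [DecidableEq ι] {u : ι → ℂ}
    {f : κ → Matrix ι ι ℂ} {μ : κ → ℂ} (h : ∀ k, u ᵥ* f k = μ k • u) :
    ∀ is : List κ, u ᵥ* (is.map f).prod = (is.map μ).prod • u
  | [] => by simp
  | k :: is => by
    rw [List.map_cons, List.map_cons, List.prod_cons, List.prod_cons, ← Matrix.vecMul_vecMul, h,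
      Matrix.smul_vecMul, vecMul_list_prod h is, smul_smul]

/-- A covector basis with the right action of `X`, `R` and `L` separates the variables. -/
theorem exists_isSoVRepresentation (hη : η ≠ 0) (hξ : Generic ℓ η ξ) {κ₁ κ₂ β : ℂ} (hκ : κ₁ ≠ 0)
    {X R L : ℂ → Op ℓ} (htr : ∀ x, transfer ℓ η ξ K x = R x + L x)
    (v : Module.Basis (State ℓ) ℂ (State ℓ → ℂ))
    (hX : ∀ h x, v h ᵥ* X x = (β * ∏ n, (x - point ℓ η ξ n (h n))) • v h)
    (hR : ∀ h n, v h ᵥ* R (point ℓ η ξ n (h n)) =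
      (κ₁ * aFun ℓ η ξ (point ℓ η ξ n (h n))) • up (fun k => v (Function.update h n k)) (h n))
    (hL : ∀ h n, v h ᵥ* L (point ℓ η ξ n (h n)) =
      (κ₂ * dFun ℓ η ξ (point ℓ η ξ n (h n))) • down (fun k => v (Function.update h n k)) (h n)) :
    ∃ Y, IsSoVRepresentation ℓ η ξ K κ₁ κ₂ β X R L v Y := by
  obtain ⟨Δ, hΔ⟩ := exists_separateVariables v
  have hY : ∀ h n, v h ᵥ* Δ (fun g : State ℓ => point ℓ η ξ n (g n)) =
      point ℓ η ξ n (h n) • v h := fun h n => hΔ _ h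
  refine ⟨fun n => Δ fun g => point ℓ η ξ n (g n), fun m n => ?_, fun x => ?_, hY, hR, hL,
    htr, ?_⟩
  · refine matrix_ext_of_basis v fun h => ?_
    simp only [← Matrix.vecMul_vecMul, hY, Matrix.smul_vecMul]
    rw [smul_comm]
  · refine matrix_ext_of_basis v fun h => ?_
    rw [hX, Matrix.vecMul_smul, List.ofFn_eq_map, vecMul_list_prod (fun n => show _ =
      (x - point ℓ η ξ n (h n)) • v h by
        rw [Matrix.vecMul_sub, hY, Matrix.vecMul_smul, Matrix.vecMul_one, sub_smul]),
      ← List.ofFn_eq_map, List.prod_ofFn, smul_smul]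
  · refine separation_of_action hξ hη hκ ?_ v fun h n => ?_
    · have h1 := (hasPolynomialEntries_monodromy ℓ η ξ K 0 0).add
        (hasPolynomialEntries_monodromy ℓ η ξ K 1 1)
      rw [← add_smul, ← Matrix.trace_fin_two] at h1
      have h2 : transfer ℓ η ξ K = fun x => monodromy ℓ η ξ K x 0 0 + monodromy ℓ η ξ K x 1 1 :=
        funext fun x => Matrix.trace_fin_two _
      rw [h2]
      exact h1
    · rw [htr, Matrix.vecMul_add, hR, hL]

/-- The matrix `P` with rows `v h` diagonalizes `X`, so the columns of `P⁻¹` are right eigenvectors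
with the same eigenvalues. -/
theorem diagonalizableSimple_of_covectors (hη : η ≠ 0) (hξ : Generic ℓ η ξ) {β : ℂ} (hβ : β ≠ 0)
    {X : ℂ → Op ℓ} (v : Module.Basis (State ℓ) ℂ (State ℓ → ℂ))
    (hX : ∀ h x, v h ᵥ* X x = (β * ∏ n, (x - point ℓ η ξ n (h n))) • v h) :
    DiagonalizableSimple X := by
  let P : Op ℓ := Matrix.of fun h g => v h g
  have hPu : IsUnit P := (Matrix.linearIndependent_rows_iff_isUnit (A := P)).mp v.linearIndependent
  have hPd := (Matrix.isUnit_iff_isUnit_det _).mp hPu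
  have hdiag : ∀ x, P * X x =
      Matrix.diagonal (fun h => β * ∏ n, (x - point ℓ η ξ n (h n))) * P := by
    intro x
    ext h g
    rw [Matrix.diagonal_mul]
    exact congrFun (hX h x) g
  have hPi : ∀ x, X x * P⁻¹ =
      P⁻¹ * Matrix.diagonal (fun h => β * ∏ n, (x - point ℓ η ξ n (h n))) := by
    intro x
    rw [← Matrix.nonsing_inv_mul_cancel_left P (X x) hPd, hdiag, Matrix.mul_assoc,
      Matrix.mul_assoc, Matrix.mul_nonsing_inv P hPd, Matrix.mul_one]
  have hli : LinearIndependent ℂ fun h => (P⁻¹).col h :=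
    Matrix.linearIndependent_cols_iff_isUnit.mpr ((Matrix.isUnit_nonsing_inv_iff).mpr hPu)
  refine ⟨basisOfLinearIndependentOfCardEqFinrank hli (by simp),
    fun h x => β * ∏ n, (x - point ℓ η ξ n (h n)), fun h g e => ?_, fun h x => ?_⟩
  · exact hξ.prod_injective hη fun x => mul_left_cancel₀ hβ (congrFun e x)
  · rw [coe_basisOfLinearIndependentOfCardEqFinrank]
    ext g
    have := congrFun (congrFun (hPi x) g) h
    rw [Matrix.mul_diagonal] at this
    rw [mul_comm] at this
    exact this

end CovectorBasis

/-! ### Symmetric powers and the action of `gl₂` -/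

section SymmetricPower

/-- The number of factors equal to the second basis vector. -/
def weight {m : ℕ} (σ : Fin m → Fin 2) : ℕ := (Finset.univ.filter fun i => σ i = 1).card

variable {m : ℕ}

theorem weight_le (σ : Fin m → Fin 2) : weight σ ≤ m :=
  (Finset.card_le_univ _).trans (by simp)

theorem weight_comp (σ : Fin m → Fin 2) (π : Equiv.Perm (Fin m)) : weight (σ ∘ π) = weight σ := by
  refine Finset.card_bij (fun i _ => π i) (by simp) (fun _ _ _ _ e => π.injective e) ?_
  intro j hj
  exact ⟨π.symm j, by simpa using hj, by simp⟩

/-- A bijection between the positions of the `1`s extends to a permutation of all positions.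
Functions of the weight are thus exactly the symmetric tensors. -/
theorem exists_perm_of_weight_eq {σ τ : Fin m → Fin 2} (h : weight σ = weight τ) :
    ∃ π : Equiv.Perm (Fin m), τ ∘ π = σ := by
  classical
  have hc : Fintype.card {i // σ i = 1} = Fintype.card {i // τ i = 1} := by
    rw [Fintype.card_subtype, Fintype.card_subtype]
    exact h
  let e := Fintype.equivOfCardEq hc
  refine ⟨e.extendSubtype, funext fun i => ?_⟩
  by_cases hi : σ i = 1
  · rw [Function.comp_apply, hi]
    exact e.extendSubtype_mem i hi
  · have h2 := e.extendSubtype_not_mem i hi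
    rw [Function.comp_apply]
    omega

theorem weight_update_one {σ : Fin m → Fin 2} {i : Fin m} (hi : σ i ≠ 1) :
    weight (Function.update σ i 1) = weight σ + 1 := by
  have h : (Finset.univ.filter fun k => Function.update σ i 1 k = 1) =
      insert i (Finset.univ.filter fun k => σ k = 1) := by
    ext k
    rcases eq_or_ne k i with rfl | hk
    · simp
    · simp [hk]
  rw [weight, weight, h, Finset.card_insert_of_notMem (by simp [hi])]

theorem weight_update_zero {σ : Fin m → Fin 2} {i : Fin m} (hi : σ i = 1) :
    weight (Function.update σ i 0) + 1 = weight σ := by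
  have h : Function.update (Function.update σ i 0) i 1 = σ := by simp [← hi]
  rw [← weight_update_one (i := i) (by simp), h]

theorem card_weight_eq (m j : ℕ) :
    (Finset.univ.filter fun σ : Fin m → Fin 2 => weight σ = j).card = m.choose j := by
  rw [← Fintype.card_fin m, ← Finset.card_univ (α := Fin m), ← Finset.card_powersetCard,
    Finset.card_univ, Fintype.card_fin]
  refine Finset.card_bij (fun σ _ => Finset.univ.filter fun i => σ i = 1) ?_ ?_ ?_
  · intro σ hσ
    exact Finset.mem_powersetCard.mpr ⟨Finset.subset_univ _, (Finset.mem_filter.mp hσ).2⟩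
  · intro σ _ τ _ e
    funext i
    have h := Finset.ext_iff.mp e i
    simp only [Finset.mem_filter, Finset.mem_univ, true_and] at h
    omega
  · intro s hs
    refine ⟨fun i => if i ∈ s then 1 else 0, ?_, ?_⟩
    · refine Finset.mem_filter.mpr ⟨Finset.mem_univ _, ?_⟩
      simpa [weight] using (Finset.mem_powersetCard.mp hs).2
    · ext i
      simp

theorem symEmbedding_apply (σ : Fin m → Fin 2) (j : Fin (m + 1)) : symEmbedding m σ j =
    if weight σ = j then (((Real.sqrt (m.choose (j : ℕ) : ℝ))⁻¹ : ℝ) : ℂ) else 0 := rfl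

theorem inv_sqrt_mul_self (c : ℕ) :
    (((Real.sqrt (c : ℝ))⁻¹ : ℝ) : ℂ) * ((Real.sqrt (c : ℝ))⁻¹ : ℝ) =
    (c : ℂ)⁻¹ := by
  rw [← Complex.ofReal_mul, ← mul_inv, Real.mul_self_sqrt (Nat.cast_nonneg c)]
  push_cast
  rfl

theorem symEmbedding_transpose_mul_self : (symEmbedding m)ᵀ * symEmbedding m = 1 := by
  ext j k
  simp only [Matrix.mul_apply, Matrix.transpose_apply, symEmbedding_apply]
  rcases eq_or_ne j k with rfl | hjk
  · have hc : ((m.choose j : ℕ) : ℂ) ≠ 0 :=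
      Nat.cast_ne_zero.mpr (Nat.choose_pos (Nat.lt_succ_iff.mp j.2)).ne'
    simp only [ite_mul, zero_mul, mul_ite, mul_zero, inv_sqrt_mul_self]
    have h1 : ∀ σ : Fin m → Fin 2, (if weight σ = j then if weight σ = j then
        ((m.choose j : ℕ) : ℂ)⁻¹ else 0 else 0) = if weight σ = j then
        ((m.choose j : ℕ) : ℂ)⁻¹ else 0 := fun σ => by split_ifs <;> rfl
    simp only [h1]
    rw [← Finset.sum_filter, Finset.sum_const, card_weight_eq, nsmul_eq_mul, mul_inv_cancel₀ hc,
      Matrix.one_apply_eq]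
  · rw [Matrix.one_apply_ne hjk]
    refine Finset.sum_eq_zero fun σ _ => ?_
    split_ifs with h1 h2
    · exact absurd (Fin.ext (h1.symm.trans h2)) hjk
    all_goals simp

/-- Symmetric tensors are fixed by the projection to the symmetric part. -/
theorem symEmbedding_mul_transpose_mulVec {f : (Fin m → Fin 2) → ℂ}
    (hf : ∀ σ τ, weight σ = weight τ → f σ = f τ) :
    (symEmbedding m * (symEmbedding m)ᵀ) *ᵥ f = f := by
  ext σ
  have hσ := Nat.lt_succ_iff.mpr (weight_le σ)
  have hc : ((m.choose (weight σ) : ℕ) : ℂ) ≠ 0 :=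
    Nat.cast_ne_zero.mpr (Nat.choose_pos (weight_le σ)).ne'
  have h : ∀ τ, (symEmbedding m * (symEmbedding m)ᵀ) σ τ * f τ =
      if weight τ = weight σ then ((m.choose (weight σ) : ℕ) : ℂ)⁻¹ * f σ else 0 := by
    intro τ
    simp only [Matrix.mul_apply, Matrix.transpose_apply, symEmbedding_apply]
    rw [Finset.sum_eq_single (⟨weight σ, hσ⟩ : Fin (m + 1))]
    · by_cases e : weight τ = weight σ
      · rw [if_pos rfl, if_pos e, if_pos e, inv_sqrt_mul_self, hf _ _ e]
      · simp [e]
    · intro j _ hj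
      rw [if_neg fun e => hj (Fin.ext e.symm), zero_mul]
    · simp
  simp only [Matrix.mulVec, dotProduct, h]
  rw [← Finset.sum_filter, Finset.sum_const, card_weight_eq, nsmul_eq_mul, mul_inv_cancel_left₀ hc]

/-- `W ⊗ ⋯ ⊗ W` with `m` factors. -/
def tensorPower (m : ℕ) (W : Matrix (Fin 2) (Fin 2) ℂ) :
    Matrix (Fin m → Fin 2) (Fin m → Fin 2) ℂ :=
  tensorOp (fun _ : Fin m => 1) fun _ => W

theorem symPower_eq (W : Matrix (Fin 2) (Fin 2) ℂ) :
    symPower m W = (symEmbedding m)ᵀ * tensorPower m W * symEmbedding m := rfl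

theorem tensorPower_mul (W W' : Matrix (Fin 2) (Fin 2) ℂ) :
    tensorPower m (W * W') = tensorPower m W * tensorPower m W' :=
  (tensorOp_mul (fun _ : Fin m => 1) (fun _ => W) fun _ => W').symm

/-- `W ⊗ ⋯ ⊗ W` commutes with permutations of the factors, hence preserves symmetric tensors. The
compression `symPower` is then a genuine restriction, and so is multiplicative. -/
theorem tensorPower_mul_symEmbedding (W : Matrix (Fin 2) (Fin 2) ℂ) :
    tensorPower m W * symEmbedding m = symEmbedding m * symPower m W := by
  rw [symPower_eq, ← Matrix.mul_assoc, ← Matrix.mul_assoc, Matrix.mul_assoc (_ * _)]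
  ext σ j
  have h := symEmbedding_mul_transpose_mulVec (f := (tensorPower m W * symEmbedding m).col j)
    fun σ τ e => by
      obtain ⟨π, rfl⟩ := exists_perm_of_weight_eq e
      simp only [Matrix.col_apply, Matrix.mul_apply, tensorPower, tensorOp, Matrix.of_apply]
      rw [← (Equiv.arrowCongr π.symm (Equiv.refl (Fin 2))).sum_comp]
      refine Finset.sum_congr rfl fun ρ _ => ?_
      have h1 : Equiv.arrowCongr π.symm (Equiv.refl (Fin 2)) ρ = ρ ∘ π := by
        ext; simp [Equiv.arrowCongr]
      rw [h1, symEmbedding_apply, symEmbedding_apply, weight_comp]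
      congr 1
      exact Equiv.prod_comp π fun i => W (τ i) (ρ i)
  exact (congrFun h σ).symm

theorem symPower_mul (W W' : Matrix (Fin 2) (Fin 2) ℂ) :
    symPower m (W * W') = symPower m W * symPower m W' := by
  rw [symPower_eq W, Matrix.mul_assoc _ _ (symPower m W'), ← tensorPower_mul_symEmbedding,
    symPower_eq (W * W'),
    tensorPower_mul]
  simp only [Matrix.mul_assoc]

theorem symPower_one : symPower m 1 = 1 := by
  rw [symPower_eq, tensorPower, tensorOp_one]
  exact (congrArg (· * symEmbedding m) (Matrix.mul_one _)).trans symEmbedding_transpose_mul_self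

/-- The action of `gl₂` on the representation of dimension `m + 1`. -/
def spinRep (m : ℕ) (X : Matrix (Fin 2) (Fin 2) ℂ) : Matrix (Fin (m + 1)) (Fin (m + 1)) ℂ :=
  X 0 1 • spinUp m + X 1 0 • spinDown m + (X 0 0 - X 1 1) • spinZ m +
    -- With this scalar term the identity matrix acts as `m`, as it does on `m` tensor factors.
    ((X 0 0 + X 1 1) * (m / 2)) • 1

/-- The action of `gl₂` on `(ℂ²)^{⊗m}`. -/
def tensorRep (m : ℕ) (X : Matrix (Fin 2) (Fin 2) ℂ) :
    Matrix (Fin m → Fin 2) (Fin m → Fin 2) ℂ :=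
  ∑ i, siteOp (fun _ : Fin m => 1) i X

/-- Only the labels that agree with `g` away from `n` contribute. -/
theorem siteOp_mulVec {N : ℕ} (ℓ : Fin N → ℕ) (n : Fin N)
    (A : Matrix (Fin (ℓ n + 1)) (Fin (ℓ n + 1)) ℂ) (f : State ℓ → ℂ) (g : State ℓ) :
    (siteOp ℓ n A *ᵥ f) g = ∑ a, A (g n) a * f (Function.update g n a) := by
  symm
  refine Finset.sum_of_injOn (fun a => Function.update g n a)
    (fun a _ b _ e => by simpa using congrFun e n) (by simp) (fun h _ hh => ?_) fun a _ => ?_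
  · change siteOp ℓ n A g h * f h = 0
    rw [siteOp_apply]
    have : ∃ k, k ≠ n ∧ g k ≠ h k := by
      by_contra! hc
      refine hh ⟨h n, by simp, ?_⟩
      funext k
      rcases eq_or_ne k n with rfl | hk
      · simp
      · simp [Function.update_of_ne hk, hc k hk]
    obtain ⟨k, hk, hgk⟩ := this
    have h0 : ∏ i ∈ Finset.univ.erase n,
        (1 : Matrix (Fin (ℓ i + 1)) (Fin (ℓ i + 1)) ℂ) (g i) (h i) = 0 :=
      Finset.prod_eq_zero (Finset.mem_erase.mpr ⟨hk, Finset.mem_univ k⟩)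
        (Matrix.one_apply_ne hgk)
    rw [h0, mul_zero, zero_mul]
  · change _ = siteOp ℓ n A g (Function.update g n a) * _
    rw [siteOp_apply, Function.update_self, Finset.prod_eq_one, mul_one]
    intro k hk
    rw [Function.update_of_ne (Finset.ne_of_mem_erase hk), Matrix.one_apply_eq]

theorem tensorPower_mul_tensorRep {W X Y : Matrix (Fin 2) (Fin 2) ℂ} (h : W * X = Y * W) :
    tensorPower m W * tensorRep m X = tensorRep m Y * tensorPower m W := by
  rw [tensorRep, tensorRep, Finset.mul_sum, Finset.sum_mul]
  refine Finset.sum_congr rfl fun i _ => ?_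
  refine (tensorOp_mul _ _ _).trans (Eq.trans ?_ (tensorOp_mul _ _ _).symm)
  congr 1
  funext k
  rcases eq_or_ne k i with rfl | hk
  · rw [Function.update_self, Function.update_self]
    exact h
  · rw [Function.update_of_ne hk, Function.update_of_ne hk]
    exact (Matrix.mul_one W).trans (Matrix.one_mul W).symm

/-- With `m.choose (k + 1) * (k + 1) = m.choose k * (m - k)`, this matches the number of factors
that can be flipped, corrected by the normalizations of the basis vectors, with a matrix element of
`S^±`. -/
theorem sqrt_choose_up {k : ℕ} (hk : k < m) :
    ((m : ℝ) - k) * (Real.sqrt (m.choose (k + 1) : ℝ))⁻¹ =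
      (Real.sqrt (m.choose k : ℝ))⁻¹ * Real.sqrt ((k + 1) * (m - k)) := by
  have hc : (0 : ℝ) < m.choose k := by exact_mod_cast Nat.choose_pos hk.le
  have hc' : (0 : ℝ) < m.choose (k + 1) := by exact_mod_cast Nat.choose_pos hk
  have hm : (0 : ℝ) < m - k := sub_pos.mpr (by exact_mod_cast hk)
  have e : (m.choose (k + 1) : ℝ) * (k + 1) = m.choose k * (m - k) := by
    have := Nat.choose_succ_right_eq m k
    rw [← Nat.cast_sub hk.le]
    exact_mod_cast this
  have key : ((m : ℝ) - k) * Real.sqrt (m.choose k) =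
      Real.sqrt ((k + 1) * (m - k)) * Real.sqrt (m.choose (k + 1)) := by
    rw [← Real.sqrt_mul (by positivity), show ((k : ℝ) + 1) * (m - k) * m.choose (k + 1) =
      (m - k) ^ 2 * m.choose k by linear_combination ((m : ℝ) - k) * e,
      Real.sqrt_mul (by positivity), Real.sqrt_sq hm.le]
  have h1 := (Real.sqrt_pos.mpr hc).ne'
  have h2 := (Real.sqrt_pos.mpr hc').ne'
  rw [← div_eq_mul_inv, inv_mul_eq_div, div_eq_div_iff h2 h1]
  exact key

theorem sqrt_choose_down {k : ℕ} (hk : k < m) :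
    ((k : ℝ) + 1) * (Real.sqrt (m.choose k : ℝ))⁻¹ =
      (Real.sqrt (m.choose (k + 1) : ℝ))⁻¹ * Real.sqrt ((k + 1) * (m - k)) := by
  have hc : (0 : ℝ) < m.choose k := by exact_mod_cast Nat.choose_pos hk.le
  have hc' : (0 : ℝ) < m.choose (k + 1) := by exact_mod_cast Nat.choose_pos hk
  have hm : (0 : ℝ) < m - k := sub_pos.mpr (by exact_mod_cast hk)
  have e : (m.choose (k + 1) : ℝ) * (k + 1) = m.choose k * (m - k) := by
    have := Nat.choose_succ_right_eq m k
    rw [← Nat.cast_sub hk.le]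
    exact_mod_cast this
  have key : ((k : ℝ) + 1) * Real.sqrt (m.choose (k + 1)) =
      Real.sqrt ((k + 1) * (m - k)) * Real.sqrt (m.choose k) := by
    rw [← Real.sqrt_mul (by positivity), show ((k : ℝ) + 1) * (m - k) * m.choose k =
      (k + 1) ^ 2 * m.choose (k + 1) by linear_combination -((k : ℝ) + 1) * e,
      Real.sqrt_mul (by positivity), Real.sqrt_sq (by positivity)]
  have h1 := (Real.sqrt_pos.mpr hc).ne'
  have h2 := (Real.sqrt_pos.mpr hc').ne'
  rw [← div_eq_mul_inv, inv_mul_eq_div, div_eq_div_iff h1 h2]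
  exact key

/-- At a basis tensor of weight `k`, a one-factor operator meets `k` factors equal to the second
basis vector and `m - k` equal to the first. Counting them gives the diagonal entries directly and
the off-diagonal ones through the binomial identities. -/
theorem tensorRep_mul_symEmbedding (X : Matrix (Fin 2) (Fin 2) ℂ) :
    tensorRep m X * symEmbedding m = symEmbedding m * spinRep m X := by
  ext σ j
  have hσ := weight_le σ
  obtain ⟨k, hk⟩ : ∃ k, k = weight σ := ⟨_, rfl⟩
  rw [← hk] at hσ
  let s : ℕ → ℂ := fun p => (((Real.sqrt (m.choose p : ℝ))⁻¹ : ℝ) : ℂ)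
  have hL : (tensorRep m X * symEmbedding m) σ j = ∑ i, ∑ a, X (σ i) a *
      symEmbedding m (Function.update σ i a) j := by
    have h1 : ∀ i, (siteOp (fun _ : Fin m => 1) i X * symEmbedding m) σ j =
        ∑ a, X (σ i) a * symEmbedding m (Function.update σ i a) j := fun i =>
      siteOp_mulVec (fun _ : Fin m => 1) i X (fun τ => symEmbedding m τ j) σ
    rw [tensorRep, Matrix.sum_mul, Matrix.sum_apply]
    exact Finset.sum_congr rfl fun i _ => h1 i
  have hL2 : ∀ i, ∑ a, X (σ i) a * symEmbedding m (Function.update σ i a) j =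
      if σ i = 1 then X 1 0 * (if k = (j : ℕ) + 1 then s j else 0) +
        X 1 1 * (if k = j then s j else 0)
      else X 0 0 * (if k = j then s j else 0) + X 0 1 * (if k + 1 = j then s j else 0) := by
    intro i
    rw [Fin.sum_univ_two]
    by_cases hi : σ i = 1
    · have h0 := weight_update_zero hi
      have h1 : Function.update σ i 1 = σ := by rw [← hi, Function.update_eq_self]
      have h2 : (weight (Function.update σ i 0) = (j : ℕ)) ↔ k = (j : ℕ) + 1 := by omega
      simp only [if_true, hi, h1, symEmbedding_apply, h2, ← hk, s]
    · have h0 := weight_update_one hi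
      have hi0 : σ i = 0 := by omega
      have h1 : Function.update σ i 0 = σ := by rw [← hi0, Function.update_eq_self]
      simp only [hi0, h1, symEmbedding_apply, h0, ← hk, s]
      simp
  have hcard : (Finset.univ.filter fun i => ¬ σ i = 1).card = m - k := by
    have := Finset.card_filter_add_card_filter_not (s := Finset.univ) fun i => σ i = 1
    rw [Finset.card_univ, Fintype.card_fin] at this
    rw [hk, weight]
    omega
  have hR : (symEmbedding m * spinRep m X) σ j = s k * spinRep m X ⟨k, by omega⟩ j := by
    rw [Matrix.mul_apply, Finset.sum_eq_single (⟨k, by omega⟩ : Fin (m + 1))]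
    · rw [symEmbedding_apply, if_pos hk.symm]
    · intro p _ hp
      rw [symEmbedding_apply, if_neg fun e => hp (Fin.ext (by simp only; omega)), zero_mul]
    · simp
  rw [hL, Finset.sum_congr rfl fun i _ => hL2 i, Finset.sum_ite, Finset.sum_const,
    Finset.sum_const, hcard, ← weight, ← hk, hR, nsmul_eq_mul, nsmul_eq_mul, Nat.cast_sub hσ]
  simp only [spinRep, spinDown, spinZ, Matrix.add_apply, Matrix.smul_apply, Matrix.transpose_apply,
    spinUp_apply, Matrix.diagonal_apply, Matrix.one_apply, smul_eq_mul, Fin.ext_iff]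
  have hj := Nat.lt_succ_iff.mp j.2
  rcases lt_trichotomy k j with hkj | hkj | hkj
  · have h1 : ¬ k = j := by omega
    have h2 : ¬ k = j + 1 := by omega
    have h3 : ¬ (j : ℕ) + 1 = k := by omega
    by_cases h : k + 1 = j
    · have hu := congrArg Complex.ofReal (sqrt_choose_up (m := m) (k := k) (by omega))
      push_cast at hu
      simp only [if_neg h1, if_neg h2, if_neg h3, if_pos h]
      simp only [s, ← h]
      push_cast
      linear_combination X 0 1 * hu
    · simp only [if_neg h1, if_neg h2, if_neg h3, if_neg h]
      ring
  · have h2 : ¬ k = j + 1 := by omega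
    have h3 : ¬ (j : ℕ) + 1 = k := by omega
    have h4 : ¬ k + 1 = (j : ℕ) := by omega
    have hs : s j = s k := by rw [hkj]
    simp only [if_neg h2, if_neg h3, if_neg h4, if_pos hkj, hs]
    ring
  · have h1 : ¬ k = j := by omega
    have h4 : ¬ k + 1 = (j : ℕ) := by omega
    by_cases h : (j : ℕ) + 1 = k
    · have hu := congrArg Complex.ofReal (sqrt_choose_down (m := m) (k := j) (by omega))
      push_cast at hu
      simp only [if_neg h1, if_neg h4, if_pos h, if_pos h.symm]
      simp only [s, ← h]
      push_cast
      linear_combination X 1 0 * hu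
    · have h2 : ¬ k = j + 1 := by omega
      simp only [if_neg h1, if_neg h2, if_neg h4, if_neg h]
      ring

/-- The identity holds factor by factor on the full tensor power and is pulled back along the
embedding, which has a left inverse. -/
theorem symPower_mul_spinRep {W X Y : Matrix (Fin 2) (Fin 2) ℂ} (h : W * X = Y * W) :
    symPower m W * spinRep m X = spinRep m Y * symPower m W := by
  have h1 : symEmbedding m * (symPower m W * spinRep m X) =
      symEmbedding m * (spinRep m Y * symPower m W) := by
    rw [← Matrix.mul_assoc, ← tensorPower_mul_symEmbedding, Matrix.mul_assoc,
      ← tensorRep_mul_symEmbedding, ← Matrix.mul_assoc, tensorPower_mul_tensorRep h,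
      Matrix.mul_assoc, tensorPower_mul_symEmbedding, ← Matrix.mul_assoc,
      tensorRep_mul_symEmbedding, Matrix.mul_assoc]
  have h2 := congrArg ((symEmbedding m)ᵀ * ·) h1
  simpa only [← Matrix.mul_assoc, symEmbedding_transpose_mul_self, Matrix.one_mul] using h2

end SymmetricPower

/-! ### `GL₂` invariance and rotated operators -/

section Twist

variable {N : ℕ} {ℓ : Fin N → ℕ} {η : ℂ} {ξ : Fin N → ℂ} {K W : Matrix (Fin 2) (Fin 2) ℂ}

theorem globalTwist_mul (W W' : Matrix (Fin 2) (Fin 2) ℂ) :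
    globalTwist ℓ (W * W') = globalTwist ℓ W * globalTwist ℓ W' := by
  rw [globalTwist, globalTwist, globalTwist, tensorOp_mul]
  simp only [symPower_mul]

theorem globalTwist_one : globalTwist ℓ 1 = 1 := by
  rw [globalTwist]
  simp only [symPower_one, tensorOp_one]

theorem isUnit_globalTwist (hW : IsUnit W.det) : IsUnit (globalTwist ℓ W) := by
  refine (Matrix.isUnit_iff_isUnit_det _).mpr (Matrix.isUnit_det_of_right_inverse
    (B := globalTwist ℓ W⁻¹) ?_)
  rw [← globalTwist_mul, Matrix.mul_nonsing_inv W hW, globalTwist_one]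

theorem globalTwist_mul_siteOp {n : Fin N} {A B : Matrix (Fin (ℓ n + 1)) (Fin (ℓ n + 1)) ℂ}
    (h : symPower (ℓ n) W * A = B * symPower (ℓ n) W) :
    globalTwist ℓ W * siteOp ℓ n A = siteOp ℓ n B * globalTwist ℓ W := by
  rw [globalTwist, siteOp, siteOp, tensorOp_mul, tensorOp_mul]
  congr 1
  funext k
  rcases eq_or_ne k n with rfl | hk
  · rw [Function.update_self, Function.update_self, h]
  · rw [Function.update_of_ne hk, Function.update_of_ne hk, Matrix.mul_one, Matrix.one_mul]

theorem aux_mul (A B : Matrix (Fin 2) (Fin 2) ℂ) : aux ℓ (A * B) = aux ℓ A * aux ℓ B := by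
  ext1 i j
  simp only [aux, Matrix.map_apply, Matrix.mul_apply, smul_mul_smul_comm, mul_one,
    Finset.sum_smul]

theorem aux_one : aux ℓ 1 = 1 := by
  ext1 i j
  simp only [aux, Matrix.map_apply, Matrix.one_apply]
  split_ifs <;> simp

/-- `A` acting on the quantum space, as a scalar on the auxiliary space. -/
def quantum (A : Op ℓ) : Matrix (Fin 2) (Fin 2) (Op ℓ) := Matrix.diagonal fun _ => A

theorem commute_quantum_aux (A : Op ℓ) (E : Matrix (Fin 2) (Fin 2) ℂ) :
    Commute (quantum A) (aux ℓ E) := by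
  rw [commute_iff_eq]
  ext1 i j
  rw [quantum, Matrix.diagonal_mul, Matrix.mul_diagonal, aux, Matrix.map_apply, mul_smul_comm,
    smul_mul_assoc, mul_one, one_mul]

theorem spinRep_add (m : ℕ) (X Y : Matrix (Fin 2) (Fin 2) ℂ) :
    spinRep m (X + Y) = spinRep m X + spinRep m Y := by
  simp only [spinRep, Matrix.add_apply]
  module

theorem spinRep_smul (m : ℕ) (c : ℂ) (X : Matrix (Fin 2) (Fin 2) ℂ) :
    spinRep m (c • X) = c • spinRep m X := by
  simp only [spinRep, Matrix.smul_apply, smul_eq_mul]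
  module

/-- The local form of the Lax operator, as a function of an auxiliary matrix. -/
def laxSymbol (m : ℕ) (η x : ℂ) : Matrix (Fin 2) (Fin 2) ℂ →ₗ[ℂ]
    Matrix (Fin (m + 1)) (Fin (m + 1)) ℂ where
  -- The term `-η (m / 2)` cancels the scalar part `(m / 2) tr X` contained in `spinRep`.
  toFun X := ((x + η / 2 - η * (m / 2)) * X.trace) • 1 + η • spinRep m X
  map_add' X Y := by
    rw [Matrix.trace_add, spinRep_add]
    module
  map_smul' c X := by
    rw [Matrix.trace_smul, spinRep_smul, smul_eq_mul, RingHom.id_apply]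
    module

theorem laxSymbol_apply (m : ℕ) (η x : ℂ) (X : Matrix (Fin 2) (Fin 2) ℂ) : laxSymbol m η x X =
    ((x + η / 2 - η * (m / 2)) * X.trace) • 1 + η • spinRep m X := rfl

/-- Indexing the entries by matrix units turns a rotation of the auxiliary space into a change of
the argument of `laxSymbol`. -/
theorem lax_apply (n : Fin N) (x : ℂ) (i j : Fin 2) :
    lax ℓ η n x i j = siteOp ℓ n (laxSymbol (ℓ n) η x (Matrix.single j i 1)) := by
  simp only [laxSymbol_apply, spinRep, ← siteHom_apply, map_add, map_smul, map_one]
  revert i j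
  simp [lax, Fin.forall_fin_two, ← siteHom_apply, Matrix.trace_fin_two, Matrix.single_apply]
  constructor <;> module

theorem symPower_mul_laxSymbol {m : ℕ} (x : ℂ) {X Y : Matrix (Fin 2) (Fin 2) ℂ}
    (hW : IsUnit W.det) (h : W * X = Y * W) :
    symPower m W * laxSymbol m η x X = laxSymbol m η x Y * symPower m W := by
  have ht : X.trace = Y.trace := by
    have : Y = W * X * W⁻¹ := by rw [h, Matrix.mul_nonsing_inv_cancel_right _ _ hW]
    rw [this, Matrix.trace_mul_comm, Matrix.nonsing_inv_mul_cancel_left _ _ hW]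
  rw [laxSymbol_apply, laxSymbol_apply, Matrix.mul_add, Matrix.add_mul, Matrix.mul_smul,
    Matrix.mul_smul, Matrix.smul_mul, Matrix.smul_mul, symPower_mul_spinRep h, ht, Matrix.mul_one,
    Matrix.one_mul]

/-- `GL₂` invariance of the Lax operator. -/
theorem commute_twist_lax (hW : IsUnit W.det) (n : Fin N) (x : ℂ) :
    Commute (aux ℓ W * quantum (globalTwist ℓ W)) (lax ℓ η n x) := by
  rw [commute_iff_eq]
  ext1 i j
  have hl : (aux ℓ W * quantum (globalTwist ℓ W) * lax ℓ η n x) i j =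
      globalTwist ℓ W * siteOp ℓ n (laxSymbol (ℓ n) η x (∑ k, W i k • Matrix.single j k 1)) := by
    rw [← (commute_quantum_aux _ _).eq, Matrix.mul_assoc, quantum, Matrix.diagonal_mul,
      Matrix.mul_apply]
    congr 1
    simp only [map_sum, map_smul, ← siteHom_apply, lax_apply, aux, Matrix.map_apply,
      smul_mul_assoc, one_mul]
  have hr : (lax ℓ η n x * (aux ℓ W * quantum (globalTwist ℓ W))) i j =
      siteOp ℓ n (laxSymbol (ℓ n) η x (∑ k, W k j • Matrix.single k i 1)) * globalTwist ℓ W := by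
    rw [← Matrix.mul_assoc, quantum, Matrix.mul_diagonal, Matrix.mul_apply]
    congr 1
    simp only [map_sum, map_smul, ← siteHom_apply, lax_apply, aux, Matrix.map_apply,
      mul_smul_comm, mul_one]
  rw [hl, hr]
  -- It remains to compare two rank-one matrices: both are column `j` of `W` times row `i` of `W`.
  refine globalTwist_mul_siteOp (symPower_mul_laxSymbol x hW ?_)
  ext a b
  revert i j a b
  simp [Fin.forall_fin_two, Matrix.mul_apply, Fin.sum_univ_two, Matrix.single_apply]

/-- `W₀𝒲` passes through the whole product of Lax matrices, so rotating the quantum space amounts to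
conjugating the monodromy matrix by `W` in the auxiliary space. -/
theorem quantum_mul_monodromy (hW : IsUnit W.det) (x : ℂ) :
    quantum (globalTwist ℓ W) * monodromy ℓ η ξ (W⁻¹ * K * W) x =
      aux ℓ W⁻¹ * monodromy ℓ η ξ K x * aux ℓ W * quantum (globalTwist ℓ W) := by
  have hc : Commute (aux ℓ W * quantum (globalTwist ℓ W))
      (List.ofFn fun n => lax ℓ η n (x - ξ n)).reverse.prod := by
    refine Commute.list_prod_right _ _ fun L hL => ?_
    obtain ⟨n, rfl⟩ := (List.mem_ofFn' _ _).mp (List.mem_reverse.mp hL)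
    exact commute_twist_lax hW n _
  rw [monodromy, monodromy, ← Matrix.mul_assoc, (commute_quantum_aux _ _).eq, aux_mul, aux_mul]
  simp only [Matrix.mul_assoc]
  rw [← hc.eq]
  simp only [Matrix.mul_assoc]

/-- Cyclicity of the trace survives noncommuting entries here because the entries of `aux ℓ E` are
scalars. -/
theorem trace_mul_aux (M : Matrix (Fin 2) (Fin 2) (Op ℓ)) (E : Matrix (Fin 2) (Fin 2) ℂ) :
    (M * aux ℓ E).trace = (aux ℓ E * M).trace := by
  simp only [Matrix.trace_fin_two, Matrix.mul_apply, Fin.sum_univ_two, aux, Matrix.map_apply,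
    mul_smul_comm, smul_mul_assoc, mul_one, one_mul]
  abel

theorem trace_aux_mul (E : Matrix (Fin 2) (Fin 2) ℂ) (M : Matrix (Fin 2) (Fin 2) (Op ℓ)) :
    (aux ℓ E * M).trace = E 0 0 • M 0 0 + E 0 1 • M 1 0 + (E 1 0 • M 0 1 + E 1 1 • M 1 1) := by
  simp only [Matrix.trace_fin_two, Matrix.mul_apply, Fin.sum_univ_two, aux, Matrix.map_apply,
    smul_mul_assoc, one_mul]

theorem rotated_eq (hW : IsUnit W.det) (E : Matrix (Fin 2) (Fin 2) ℂ) (x : ℂ) :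
    rotated ℓ η ξ K W E x = globalTwist ℓ W *
      (aux ℓ E * monodromy ℓ η ξ (W⁻¹ * K * W) x).trace * (globalTwist ℓ W)⁻¹ := by
  have hU := (Matrix.isUnit_iff_isUnit_det _).mp (isUnit_globalTwist (ℓ := ℓ) hW)
  have h1 : rotated ℓ η ξ K W E x =
      (aux ℓ E * (aux ℓ W⁻¹ * monodromy ℓ η ξ K x * aux ℓ W)).trace := by
    rw [rotated, aux_mul, aux_mul, ← Matrix.mul_assoc, trace_mul_aux]
    simp only [Matrix.mul_assoc]
  have h2 : aux ℓ W⁻¹ * monodromy ℓ η ξ K x * aux ℓ W = quantum (globalTwist ℓ W) *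
      monodromy ℓ η ξ (W⁻¹ * K * W) x * quantum (globalTwist ℓ W)⁻¹ := by
    rw [quantum_mul_monodromy hW, Matrix.mul_assoc _ (quantum _)]
    have : quantum (globalTwist ℓ W) * quantum (globalTwist ℓ W)⁻¹ = 1 := by
      rw [quantum, quantum, Matrix.diagonal_mul_diagonal, ← Matrix.diagonal_one]
      simp only [Matrix.mul_nonsing_inv _ hU]
    rw [this, Matrix.mul_one]
  rw [h1, h2, trace_aux_mul, trace_aux_mul]
  simp only [quantum, Matrix.mul_diagonal, Matrix.diagonal_mul, mul_smul_comm, smul_mul_assoc,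
    mul_add, add_mul]

theorem rotated_opA (hW : IsUnit W.det) (x : ℂ) : rotated ℓ η ξ K W !![1, 0; 0, 0] x =
    globalTwist ℓ W * opA ℓ η ξ (W⁻¹ * K * W) x * (globalTwist ℓ W)⁻¹ := by
  rw [rotated_eq hW, trace_aux_mul]
  simp [opA]

theorem rotated_opB (hW : IsUnit W.det) (x : ℂ) : rotated ℓ η ξ K W !![0, 0; 1, 0] x =
    globalTwist ℓ W * opB ℓ η ξ (W⁻¹ * K * W) x * (globalTwist ℓ W)⁻¹ := by
  rw [rotated_eq hW, trace_aux_mul]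
  simp [opB]

theorem rotated_opC (hW : IsUnit W.det) (x : ℂ) : rotated ℓ η ξ K W !![0, 1; 0, 0] x =
    globalTwist ℓ W * opC ℓ η ξ (W⁻¹ * K * W) x * (globalTwist ℓ W)⁻¹ := by
  rw [rotated_eq hW, trace_aux_mul]
  simp [opC]

theorem rotated_opD (hW : IsUnit W.det) (x : ℂ) : rotated ℓ η ξ K W !![0, 0; 0, 1] x =
    globalTwist ℓ W * opD ℓ η ξ (W⁻¹ * K * W) x * (globalTwist ℓ W)⁻¹ := by
  rw [rotated_eq hW, trace_aux_mul]
  simp [opD]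

theorem transfer_eq_rotated (hW : IsUnit W.det) (x : ℂ) : transfer ℓ η ξ K x =
    rotated ℓ η ξ K W !![1, 0; 0, 0] x + rotated ℓ η ξ K W !![0, 0; 0, 1] x := by
  rw [rotated, rotated, ← Matrix.trace_add, ← Matrix.add_mul, transfer]
  have h : aux ℓ (W * !![1, 0; 0, 0] * W⁻¹) + aux ℓ (W * !![0, 0; 0, 1] * W⁻¹) = 1 := by
    have h1 : W * !![1, 0; 0, 0] * W⁻¹ + W * !![0, 0; 0, 1] * W⁻¹ = 1 := by
      have h2 : (!![1, 0; 0, 0] + !![0, 0; 0, 1] : Matrix (Fin 2) (Fin 2) ℂ) = 1 := by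
        ext i j
        revert i j
        simp [Fin.forall_fin_two]
      rw [← Matrix.add_mul, ← Matrix.mul_add, h2, Matrix.mul_one, Matrix.mul_nonsing_inv W hW]
    rw [← aux_one, ← h1]
    ext1 i j
    simp [aux, add_smul]
  rw [h, Matrix.one_mul]

/-- Separation of variables in the basis rotated by `W`. -/
theorem separation_rotated (hη : η ≠ 0) (hξ : Generic ℓ η ξ) (hW : IsUnit W.det)
    (hb : (W⁻¹ * K * W) 0 1 ≠ 0) :
    DiagonalizableSimple (rotated ℓ η ξ K W !![0, 0; 1, 0]) ∧
      AdmitsSoV ℓ η ξ K ((W⁻¹ * K * W) 0 1) (rotated ℓ η ξ K W !![0, 0; 1, 0])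
        (rotated ℓ η ξ K W !![1, 0; 0, 0]) (rotated ℓ η ξ K W !![0, 0; 0, 1]) := by
  set U := globalTwist ℓ W with hUdef
  have hU := (Matrix.isUnit_iff_isUnit_det _).mp (isUnit_globalTwist (ℓ := ℓ) hW)
  have hconj : ∀ (u : State ℓ → ℂ) (A : Op ℓ), u ᵥ* U⁻¹ ᵥ* (U * A * U⁻¹) = u ᵥ* A ᵥ* U⁻¹ := by
    intro u A
    rw [Matrix.vecMul_vecMul, Matrix.mul_assoc, Matrix.nonsing_inv_mul_cancel_left _ _ hU,
      Matrix.vecMul_vecMul]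
  have hdet : (W⁻¹ * K * W).det = K.det := by
    rw [Matrix.det_mul, Matrix.det_mul, mul_right_comm, ← Matrix.det_mul,
      Matrix.nonsing_inv_mul W hW, Matrix.det_one, one_mul]
  -- Right multiplication by `𝒲⁻¹` carries eigencovectors for the twist `W⁻¹KW` to eigencovectors of
  -- the rotated operators.
  let e : (State ℓ → ℂ) ≃ₗ[ℂ] (State ℓ → ℂ) := LinearEquiv.ofLinearMap
    (Matrix.vecMulLinear U⁻¹) (Matrix.vecMulLinear U)
    (LinearMap.ext fun u => by
      simp [Matrix.vecMul_vecMul, Matrix.mul_nonsing_inv U hU])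
    (LinearMap.ext fun u => by
      simp [Matrix.vecMul_vecMul, Matrix.nonsing_inv_mul U hU])
  have he : ∀ (v : Module.Basis (State ℓ) ℂ (State ℓ → ℂ)) h, v.map e h = v h ᵥ* U⁻¹ :=
    fun v h => v.map_apply e h
  have hX : ∀ v : Module.Basis (State ℓ) ℂ (State ℓ → ℂ),
      (∀ h x, v h ᵥ* opB ℓ η ξ (W⁻¹ * K * W) x =
        ((W⁻¹ * K * W) 0 1 * ∏ n, (x - point ℓ η ξ n (h n))) • v h) →
      ∀ h x, v.map e h ᵥ* rotated ℓ η ξ K W !![0, 0; 1, 0] x =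
        ((W⁻¹ * K * W) 0 1 * ∏ n, (x - point ℓ η ξ n (h n))) • v.map e h := by
    intro v hv h x
    rw [he, rotated_opB hW, hconj, hv, Matrix.smul_vecMul]
  refine ⟨?_, fun κ₁ κ₂ hκ hκdet => ?_⟩
  · obtain ⟨v, hvB, -⟩ := exists_covectorBasis hη hξ hb one_ne_zero
    exact diagonalizableSimple_of_covectors hη hξ hb (v.map e) (hX v hvB)
  · obtain ⟨v, hvB, hvA⟩ := exists_covectorBasis hη hξ hb hκ
    have hvD := lowering_of_raising hη hξ hb hκ (hκdet.trans hdet.symm) v hvB hvA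
    refine ⟨v.map e, exists_isSoVRepresentation hη hξ hκ (transfer_eq_rotated hW) (v.map e)
      (hX v hvB) (fun h n => ?_) (fun h n => ?_)⟩
    · rw [he, rotated_opA hW, hconj, hvA, Matrix.smul_vecMul]
      congr 1
      simp only [up, he]
      split_ifs <;> simp
    · rw [he, rotated_opD hW, hconj, hvD, Matrix.smul_vecMul]
      congr 1
      simp only [down, he]
      split_ifs <;> simp

end Twist

/-! ### Exchange of `B` and `C`, and the choice of `W` -/

section Main

variable {N : ℕ} {ℓ : Fin N → ℕ} {η : ℂ} {ξ : Fin N → ℂ} {K W : Matrix (Fin 2) (Fin 2) ℂ}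

theorem rotated_congr {W' E E' : Matrix (Fin 2) (Fin 2) ℂ} (h : W * E * W⁻¹ = W' * E' * W'⁻¹) :
    rotated ℓ η ξ K W E = rotated ℓ η ξ K W' E' := by
  funext x
  rw [rotated, rotated, h]

theorem rotated_one (E : Matrix (Fin 2) (Fin 2) ℂ) (x : ℂ) : rotated ℓ η ξ K 1 E x =
    (aux ℓ E * monodromy ℓ η ξ K x).trace := by
  rw [rotated, inv_one, Matrix.one_mul, Matrix.mul_one]

/-- The permutation matrix exchanging the two basis vectors of the auxiliary space. -/
def swapMatrix : Matrix (Fin 2) (Fin 2) ℂ := !![0, 1; 1, 0]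

theorem swapMatrix_mul_self : swapMatrix * swapMatrix = 1 := by
  ext i j
  revert i j
  simp [swapMatrix, Fin.forall_fin_two]

theorem swapMatrix_inv : swapMatrix⁻¹ = swapMatrix :=
  Matrix.inv_eq_right_inv swapMatrix_mul_self

theorem swapMatrix_conj (E : Matrix (Fin 2) (Fin 2) ℂ) :
    swapMatrix * E * swapMatrix = !![E 1 1, E 1 0; E 0 1, E 0 0] := by
  ext i j
  revert i j
  simp [swapMatrix, Fin.forall_fin_two, Matrix.mul_apply, Fin.sum_univ_two, Matrix.vecMul,
    dotProduct]

/-- Replacing `W` by `W * swapMatrix` exchanges `B` with `C` and `A` with `D`, and moves the lower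
off-diagonal entry of the twist to the upper one. -/
theorem separation_rotated_swap (hη : η ≠ 0) (hξ : Generic ℓ η ξ) (hW : IsUnit W.det)
    (hc : (W⁻¹ * K * W) 1 0 ≠ 0) :
    DiagonalizableSimple (rotated ℓ η ξ K W !![0, 1; 0, 0]) ∧
      AdmitsSoV ℓ η ξ K ((W⁻¹ * K * W) 1 0) (rotated ℓ η ξ K W !![0, 1; 0, 0])
        (rotated ℓ η ξ K W !![0, 0; 0, 1]) (rotated ℓ η ξ K W !![1, 0; 0, 0]) := by
  have hconj : ∀ E : Matrix (Fin 2) (Fin 2) ℂ, rotated ℓ η ξ K (W * swapMatrix) E =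
      rotated ℓ η ξ K W !![E 1 1, E 1 0; E 0 1, E 0 0] := fun E => by
    refine rotated_congr ?_
    rw [Matrix.mul_inv_rev, swapMatrix_inv, ← swapMatrix_conj]
    simp only [Matrix.mul_assoc]
  have hK : (W * swapMatrix)⁻¹ * K * (W * swapMatrix) =
      swapMatrix * (W⁻¹ * K * W) * swapMatrix := by
    rw [Matrix.mul_inv_rev, swapMatrix_inv]
    simp only [Matrix.mul_assoc]
  have hb : ((W * swapMatrix)⁻¹ * K * (W * swapMatrix)) 0 1 = (W⁻¹ * K * W) 1 0 := by
    rw [hK, swapMatrix_conj]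
    rfl
  have hWs : IsUnit (W * swapMatrix).det := by
    rw [Matrix.det_mul]
    exact hW.mul (by simp [swapMatrix, Matrix.det_fin_two])
  have h := separation_rotated hη hξ hWs (hb.symm ▸ hc)
  rw [hb] at h
  simpa [hconj] using h

/-- An off-diagonal entry of `W⁻¹KW` vanishes exactly when a column of `W` is an eigenvector of `K`.
A non-scalar `K` has at most two eigenlines, which the columns can avoid. -/
theorem exists_generic_twist (hK : ∀ α : ℂ, K ≠ α • (1 : Matrix (Fin 2) (Fin 2) ℂ)) :
    ∃ W : Matrix (Fin 2) (Fin 2) ℂ, IsUnit W.det ∧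
      (W⁻¹ * K * W) 0 1 ≠ 0 ∧ (W⁻¹ * K * W) 1 0 ≠ 0 := by
  -- The adjugate differs from the inverse by the nonzero factor `det W`, so the conditions become
  -- polynomial.
  have key : ∀ W : Matrix (Fin 2) (Fin 2) ℂ, W.det ≠ 0 → (W.adjugate * K * W) 0 1 ≠ 0 →
      (W.adjugate * K * W) 1 0 ≠ 0 → ∃ W : Matrix (Fin 2) (Fin 2) ℂ, IsUnit W.det ∧
      (W⁻¹ * K * W) 0 1 ≠ 0 ∧ (W⁻¹ * K * W) 1 0 ≠ 0 := by
    intro W h h1 h2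
    refine ⟨W, isUnit_iff_ne_zero.mpr h, ?_, ?_⟩ <;>
      simp only [Matrix.inv_def, Matrix.smul_mul, Matrix.smul_apply, Ring.inverse_eq_inv',
        smul_eq_mul]
    exacts [mul_ne_zero (inv_ne_zero h) h1, mul_ne_zero (inv_ne_zero h) h2]
  by_cases hb : K 0 1 = 0 <;> by_cases hc : K 1 0 = 0
  · have had : K 0 0 ≠ K 1 1 := by
      intro e
      refine hK (K 0 0) ?_
      ext i j
      revert i j
      simp [Fin.forall_fin_two, hb, hc, e]
    have h1 := sub_ne_zero.mpr had
    refine key !![1, 1; 1, -1] ?_ ?_ ?_ <;>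
      simp [Matrix.det_fin_two, Matrix.adjugate_fin_two, Matrix.mul_apply, Fin.sum_univ_two,
        Matrix.vecMul, dotProduct, hb, hc]
    · norm_num
    · exact fun e => h1 (by linear_combination -e)
    · exact fun e => h1 (by linear_combination -e)
  -- If both `t = 1` and `t = -1` failed, adding the two equations would give `K 1 0 = 0`.
  · have h : ∃ t : ℂ, t ≠ 0 ∧ t * K 0 0 - (K 1 0 + K 1 1 * t) ≠ 0 := by
      by_contra! hcon
      refine hc ?_
      linear_combination -(hcon 1 one_ne_zero) / 2 - hcon (-1) (neg_ne_zero.mpr one_ne_zero) / 2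
    obtain ⟨t, ht, h⟩ := h
    refine key !![1, 1; 0, t] ?_ ?_ ?_ <;>
      simp [Matrix.det_fin_two, Matrix.adjugate_fin_two, Matrix.mul_apply, Fin.sum_univ_two,
        Matrix.vecMul, dotProduct, hb, hc, ht]
    exact fun e => h (by linear_combination e)
  · have h : ∃ t : ℂ, t ≠ 0 ∧ t * K 1 1 - (K 0 1 + K 0 0 * t) ≠ 0 := by
      by_contra! hcon
      refine hb ?_
      linear_combination -(hcon 1 one_ne_zero) / 2 - hcon (-1) (neg_ne_zero.mpr one_ne_zero) / 2
    obtain ⟨t, ht, h⟩ := h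
    refine key !![t, 0; 1, 1] ?_ ?_ ?_ <;>
      simp [Matrix.det_fin_two, Matrix.adjugate_fin_two, Matrix.mul_apply, Fin.sum_univ_two,
        Matrix.vecMul, dotProduct, hb, hc, ht]
    exact fun e => h (by linear_combination e)
  · exact key 1 (by simp) (by simpa using hb) (by simpa using hc)

end Main

end HigherSpin

end

theorem theorem3p1 {N : ℕ} (ℓ : Fin N → ℕ) (hℓ : ∀ n, 0 < ℓ n) (η : ℂ) (hη : η ≠ 0)
    (ξ : Fin N → ℂ)
    (hξ : ∀ i j, i ≠ j → ∀ k : ℤ,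
      (ξ i + (ℓ i : ℂ) / 2 * η) - (ξ j + (ℓ j : ℂ) / 2 * η) ≠ (k : ℂ) * η)
    (K : Matrix (Fin 2) (Fin 2) ℂ) (hK : ∀ α : ℂ, K ≠ α • (1 : Matrix (Fin 2) (Fin 2) ℂ)) :
    (∃ W : Matrix (Fin 2) (Fin 2) ℂ, IsUnit W.det ∧
      (W⁻¹ * K * W) 0 1 ≠ 0 ∧ (W⁻¹ * K * W) 1 0 ≠ 0) ∧
    (K 0 1 ≠ 0 →
      HigherSpin.DiagonalizableSimple (HigherSpin.opB ℓ η ξ K) ∧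
      HigherSpin.AdmitsSoV ℓ η ξ K (K 0 1) (HigherSpin.opB ℓ η ξ K)
        (HigherSpin.opA ℓ η ξ K) (HigherSpin.opD ℓ η ξ K)) ∧
    (K 1 0 ≠ 0 →
      HigherSpin.DiagonalizableSimple (HigherSpin.opC ℓ η ξ K) ∧
      HigherSpin.AdmitsSoV ℓ η ξ K (K 1 0) (HigherSpin.opC ℓ η ξ K)
        (HigherSpin.opD ℓ η ξ K) (HigherSpin.opA ℓ η ξ K)) ∧
    (K 0 1 = 0 → ∀ W : Matrix (Fin 2) (Fin 2) ℂ, IsUnit W.det → (W⁻¹ * K * W) 0 1 ≠ 0 →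
      IsUnit (HigherSpin.globalTwist ℓ W) ∧
      (∀ x, HigherSpin.rotated ℓ η ξ K W !![0, 0; 1, 0] x =
        HigherSpin.globalTwist ℓ W * HigherSpin.opB ℓ η ξ (W⁻¹ * K * W) x *
          (HigherSpin.globalTwist ℓ W)⁻¹) ∧
      HigherSpin.DiagonalizableSimple (HigherSpin.rotated ℓ η ξ K W !![0, 0; 1, 0]) ∧
      HigherSpin.AdmitsSoV ℓ η ξ K ((W⁻¹ * K * W) 0 1)
        (HigherSpin.rotated ℓ η ξ K W !![0, 0; 1, 0])
        (HigherSpin.rotated ℓ η ξ K W !![1, 0; 0, 0])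
        (HigherSpin.rotated ℓ η ξ K W !![0, 0; 0, 1])) ∧
    (K 1 0 = 0 → ∀ W : Matrix (Fin 2) (Fin 2) ℂ, IsUnit W.det → (W⁻¹ * K * W) 1 0 ≠ 0 →
      IsUnit (HigherSpin.globalTwist ℓ W) ∧
      (∀ x, HigherSpin.rotated ℓ η ξ K W !![0, 1; 0, 0] x =
        HigherSpin.globalTwist ℓ W * HigherSpin.opC ℓ η ξ (W⁻¹ * K * W) x *
          (HigherSpin.globalTwist ℓ W)⁻¹) ∧
      HigherSpin.DiagonalizableSimple (HigherSpin.rotated ℓ η ξ K W !![0, 1; 0, 0]) ∧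
      HigherSpin.AdmitsSoV ℓ η ξ K ((W⁻¹ * K * W) 1 0)
        (HigherSpin.rotated ℓ η ξ K W !![0, 1; 0, 0])
        (HigherSpin.rotated ℓ η ξ K W !![0, 0; 0, 1])
        (HigherSpin.rotated ℓ η ξ K W !![1, 0; 0, 0])) := by
  have hg : HigherSpin.Generic ℓ η ξ := hξ
  have h1 : IsUnit (1 : Matrix (Fin 2) (Fin 2) ℂ).det := by simp
  -- The unrotated statements are the rotated ones at `W = 1`.
  have hK1 : (1 : Matrix (Fin 2) (Fin 2) ℂ)⁻¹ * K * 1 = K := by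
    rw [inv_one, Matrix.one_mul, Matrix.mul_one]
  have hA : HigherSpin.rotated ℓ η ξ K 1 !![1, 0; 0, 0] = HigherSpin.opA ℓ η ξ K := by
    funext x
    simp [HigherSpin.rotated_one, HigherSpin.trace_aux_mul, HigherSpin.opA]
  have hB : HigherSpin.rotated ℓ η ξ K 1 !![0, 0; 1, 0] = HigherSpin.opB ℓ η ξ K := by
    funext x
    simp [HigherSpin.rotated_one, HigherSpin.trace_aux_mul, HigherSpin.opB]
  have hC : HigherSpin.rotated ℓ η ξ K 1 !![0, 1; 0, 0] = HigherSpin.opC ℓ η ξ K := by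
    funext x
    simp [HigherSpin.rotated_one, HigherSpin.trace_aux_mul, HigherSpin.opC]
  have hD : HigherSpin.rotated ℓ η ξ K 1 !![0, 0; 0, 1] = HigherSpin.opD ℓ η ξ K := by
    funext x
    simp [HigherSpin.rotated_one, HigherSpin.trace_aux_mul, HigherSpin.opD]
  refine ⟨HigherSpin.exists_generic_twist hK, fun hb => ?_, fun hc => ?_, fun _ W hW hb => ?_,
    fun _ W hW hc => ?_⟩
  · have h := HigherSpin.separation_rotated hη hg h1 (hK1.symm ▸ hb)
    rwa [hA, hB, hD, hK1] at h
  · have h := HigherSpin.separation_rotated_swap hη hg h1 (hK1.symm ▸ hc)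
    rwa [hA, hC, hD, hK1] at h
  · exact ⟨HigherSpin.isUnit_globalTwist hW, HigherSpin.rotated_opB hW,
      HigherSpin.separation_rotated hη hg hW hb⟩
  · exact ⟨HigherSpin.isUnit_globalTwist hW, HigherSpin.rotated_opC hW,
      HigherSpin.separation_rotated_swap hη hg hW hc⟩
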